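/- Let $d\in\{2,3\}$ and let $\mathcal T^H$ be a finite partition of a domain $D\subset\mathbb R^d$ into closed convex polytopes with nonempty, pairwise disjoint interiors (so $\bigcup_{K\in\mathcal T^H} K=\overline D$ and $D$ is the interior of this union). Let $\mathcal T^h$ be a partition of $D$ of the same kind that refines $\mathcal T^H$. A face of a partition is a $(d-1)$-dimensional intersection of two distinct elements. Let $E_1,\dots,E_{N_e}$, $N_e\ge 1$, be the faces of $\mathcal T^H$. For each $\ell$ let $\mathbf m_\ell$ be a fixed unit normal of $E_\ell$, let $\omega_\ell:=\bigcup\{K\in\mathcal T^H: E_\ell\subset K\}$, and let $e_1,\dots,e_{J_\ell}$ be the faces of $\mathcal T^h$ contained in $E_\ell$. Let $\kappa$ be measurable with $0<\kappa_{\min}\le\kappa\le\kappa_{\max}$ a.e. in $D$, and put $a(v,w):=\int_D\kappa^{-1}v\cdot w\,dx$ for $v,w\in L^2(D;\mathbb R^d)$. Fields on subsets of $D$ are extended by zero, and all equations and normal traces are understood in the weak sense. For $1\le j\le J_\ell$ let $\psi_{\rm snap}^{\ell,j}$ be the velocity component of the solution of the following problem. On each element $K\subset\omega_\ell$, $$\kappa^{-1}\psi_{\rm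 snap}^{\ell,j}+\nabla p_{\rm snap}^{\ell,j}=0,\qquad \nabla\cdot\psi_{\rm snap}^{\ell,j}=\alpha_K,\qquad \int_K p_{\rm snap}^{\ell,j}\,dx=0 .$$ Further, $\psi_{\rm snap}^{\ell,j}\cdot\mathbf m_\ell=\delta_j^\ell$ on $E_\ell$ from both sides, where $\delta_j^\ell=|e_j|^{-1}$ on $e_j$ and $\delta_j^\ell=0$ on $E_\ell\setminus e_j$, and $\psi_{\rm snap}^{\ell,j}\cdot\mathbf n=0$ on $\partial\omega_\ell\setminus E_\ell$. Here $\alpha_K=\sigma_K|K|^{-1}\int_{E_\ell}\delta_j^\ell\,dS$, with $\sigma_K=\pm1$ according to whether $\mathbf m_\ell$ points out of or into $K$. Let $V_{\rm snap}^{(\ell)}:=\mathrm{span}\{\psi_{\rm snap}^{\ell,j}\}_{j}$, $V_{\rm snap}:=\sum_\ell V_{\rm snap}^{(\ell)}$ and $V_{{\rm snap},2}^{(\ell)}:=\{v\in V_{\rm snap}^{(\ell)}:\int_{E_\ell}v\cdot\mathbf m_\ell\,dS=0\}$. For $v\in V_{{\rm snap},2}^{(\ell)}$ let $\mathcal H_\ell(v)$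 be the minimizer of $\int_{\omega_\ell}\kappa^{-1}|w|^2\,dx$ over all restrictions $w$ to $\omega_\ell$ of elements of $V_{\rm snap}$ with $w\cdot\mathbf m_\ell=v\cdot\mathbf m_\ell$ on $E_\ell$. Let $\lambda_1^{(\ell)}\le\lambda_2^{(\ell)}\le\cdots\le\lambda_{n_\ell}^{(\ell)}$, $n_\ell=\dim V_{{\rm snap},2}^{(\ell)}$, be the eigenvalues, counted with multiplicity, of the problem: find $\varphi_j^{(\ell)}\in V_{{\rm snap},2}^{(\ell)}$ with $$\int_{\omega_\ell}\kappa^{-1}\mathcal H_\ell(\varphi_j^{(\ell)})\cdot\mathcal H_\ell(v)\,dx=\lambda_j^{(\ell)}\int_{\omega_\ell}\kappa^{-1}\varphi_j^{(\ell)}\cdot v\,dx\qquad\forall v\in V_{{\rm snap},2}^{(\ell)},$$ where $\{\varphi_j^{(\ell)}\}_{j=1}^{n_\ell}$ is a basis of $V_{{\rm snap},2}^{(\ell)}$ consisting of eigenfunctions. For each $\ell$ fix an integer $0\le\mathcal J_{\ell,2}<n_\ell$, let $V_{\rm sms}^{(\ell)}:=\mathrm{span}\{\varphi_j^{(\ell)}:j\le\mathcal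 J_{\ell,2}\}$, and let $\tilde V_{\rm sms}^{(\ell)}$ be the $a$-orthogonal complement of $V_{\rm sms}^{(\ell)}$ in $V_{{\rm snap},2}^{(\ell)}$. Choose a basis of each $\tilde V_{\rm sms}^{(\ell)}$. Let $A$ be the matrix with entries $a(\theta_j,\theta_i)$, where $\{\theta_i\}$ is the concatenation of these bases, and let $A_{\rm pre}$ be its block diagonal part, with blocks indexed by $\ell$. Then $A_{\rm pre}$ is invertible, all eigenvalues of $A_{\rm pre}^{-1}A$ are real, and its minimum eigenvalue $\mu_{\min}$ and maximum eigenvalue $\mu_{\max}$ satisfy $$\Lambda M_1^{-1}\le\mu_{\min}\le\mu_{\max}\le M_2,$$ where $$M_1=\max_{K\in\mathcal T^H}\bigl|\{\ell: K\subseteq\omega_\ell\}\bigr|,\qquad M_2=\max_{\ell}\bigl|\{s:\tilde V_{\rm sms}^{(s)}\not\perp_a\tilde V_{\rm sms}^{(\ell)}\}\bigr|,\qquad \Lambda=\min_\ell\lambda_{\mathcal J_{\ell,2}+1}^{(\ell)} .$$ -/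

import Mathlib

open MeasureTheory Module
open scoped ContDiff Classical

noncomputable section

namespace CEMGMsFEM

/-- Points and vectors of `ℝ^d`, with the Euclidean norm. -/
abbrev Pt (d : ℕ) := EuclideanSpace ℝ (Fin d)

/-- The space `L²(D; ℝ^d)` of velocity fields. Fields living on a subset of `D` are extended
by zero. -/
abbrev VecL2 {d : ℕ} (D : Set (Pt d)) := Lp (Pt d) 2 ((volume : Measure (Pt d)).restrict D)

/-- Surface measure on `(d-1)`-dimensional subsets of `ℝ^d`. -/
abbrev surf (d : ℕ) : Measure (Pt d) := Measure.euclideanHausdorffMeasure (d - 1)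

/-! ### Meshes -/

/-- A partition of `D` into finitely many (closed, convex) polytopes. -/
structure Mesh {d : ℕ} (D : Set (Pt d)) where
  /-- the elements of the partition -/
  cells : Finset (Set (Pt d))
  polytope : ∀ K ∈ cells, ∃ s : Finset (Pt d), K = convexHull ℝ (s : Set (Pt d))
  nonempty_interior : ∀ K ∈ cells, (interior K).Nonempty
  disjoint_interior : ∀ K ∈ cells, ∀ K' ∈ cells, K ≠ K' → Disjoint (interior K) (interior K')
  union_eq : (⋃ K ∈ cells, K) = closure D
  interior_union_eq : interior (⋃ K ∈ cells, K) = D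

namespace Mesh

variable {d : ℕ} {D : Set (Pt d)}

/-- The (interior) faces of a mesh: the intersections of two distinct elements that have
dimension `d - 1`. -/
def faces (T : Mesh D) : Finset (Set (Pt d)) :=
  (T.cells.offDiag.image fun P => P.1 ∩ P.2).filter
    fun E => finrank ℝ (vectorSpan ℝ E) + 1 = d

/-- The neighborhood `ω_E` of a face: the union of the elements that contain `E`. -/
def nbhd (T : Mesh D) (E : Set (Pt d)) : Set (Pt d) :=
  ⋃ K ∈ T.cells.filter fun K => E ⊆ K, K

end Mesh

/-- A coarse mesh of `D`, a fine mesh that refines it, and a choice of a unit normal vector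
on each coarse face. -/
structure Grid {d : ℕ} (D : Set (Pt d)) where
  coarse : Mesh D
  fine : Mesh D
  refines : ∀ τ ∈ fine.cells, ∃ K ∈ coarse.cells, τ ⊆ K
  normal : coarse.faces → Pt d
  norm_normal : ∀ E, ‖normal E‖ = 1
  normal_orthogonal : ∀ E, ∀ x ∈ E.1, ∀ y ∈ E.1, inner ℝ (normal E) (x - y) = 0

namespace Grid

variable {d : ℕ} {D : Set (Pt d)} (G : Grid D)

/-- The index set of the coarse faces. -/
abbrev Face := {E // E ∈ G.coarse.faces}

/-- The coarse neighborhood of a coarse face. -/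
def omega (E : G.Face) : Set (Pt d) := G.coarse.nbhd E.1

/-- The fine faces lying on the coarse face `E`. -/
abbrev FineFace (E : G.Face) := {e // e ∈ G.fine.faces.filter fun e => e ⊆ E.1}

/-- For a coarse element `K` with face `E`: the sign `s` such that `s • normal E` is the unit
normal vector on `E` pointing out of `K`. -/
def outSign (E : G.Face) (K : Set (Pt d)) : ℝ :=
  if ∀ x ∈ K, ∀ y ∈ E.1, inner ℝ (G.normal E) (x - y) ≤ 0 then 1 else -1

end Grid

/-! ### Weak derivatives and normal traces -/

/-- The (classical) divergence of a smooth vector field. -/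
def diverg {d : ℕ} (φ : Pt d → Pt d) (x : Pt d) : ℝ :=
  ∑ i : Fin d, (fderiv ℝ φ x (EuclideanSpace.single i 1)) i

/-- `g = ∇ p` on the open set `U` in the weak sense. -/
def IsWeakGrad {d : ℕ} (U : Set (Pt d)) (p : Pt d → ℝ) (g : Pt d → Pt d) : Prop :=
  ∀ φ : Pt d → Pt d, ContDiff ℝ ∞ φ → HasCompactSupport φ → tsupport φ ⊆ U →
    ∫ x in U, p x * diverg φ x = - ∫ x in U, inner ℝ (g x) (φ x)

/-- `∇ · u = f` in the interior of `K`, and `u · n = g` on the part `S` of the boundary of `K`,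
where `n` is the outward unit normal; both in the weak sense, through Green's formula with
smooth test functions that vanish on `∂K` away from `S`. -/
def HasDivAndTrace {d : ℕ} (K S : Set (Pt d)) (u : Pt d → Pt d) (f g : Pt d → ℝ) : Prop :=
  ∀ q : Pt d → ℝ, ContDiff ℝ ∞ q → HasCompactSupport q → tsupport q ∩ frontier K ⊆ S →
    (∫ x in K, inner ℝ (u x) (gradient q x)) + ∫ x in K, f x * q x
      = ∫ x in S, g x * q x ∂(surf d)

namespace Grid

variable {d : ℕ} {D : Set (Pt d)} (G : Grid D)

/-- `u · m = g` on the coarse face `E`, where `m` is the chosen normal: on each of the elements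
having `E` as a face, `u` has a square integrable divergence and normal trace `g` on `E`. -/
def HasNormalTrace (E : G.Face) (u : Pt d → Pt d) (g : Pt d → ℝ) : Prop :=
  IntegrableOn g E.1 (surf d) ∧
  ∀ K ∈ G.coarse.cells, E.1 ⊆ K → ∃ f : Pt d → ℝ,
    MemLp f 2 (volume.restrict K) ∧
      HasDivAndTrace K E.1 u f fun x => G.outSign E K * g x

/-! ### Snapshots -/

/-- The flux on `E` prescribed for the snapshot of the fine face `e`: it is `|e|⁻¹` on `e` and
zero on the other fine faces. -/
def flux (E : G.Face) (e : G.FineFace E) : Pt d → ℝ :=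
  e.1.indicator fun _ => ((surf d).real e.1)⁻¹

/-- The constant divergence on `K` of the snapshot of `e`, fixed by the divergence theorem. -/
def divConst (E : G.Face) (e : G.FineFace E) (K : Set (Pt d)) : ℝ :=
  (volume.real K)⁻¹ * ∫ x in E.1, G.outSign E K * G.flux E e x ∂(surf d)

/-- `ψ` is the velocity component of a solution `(ψ, p)` of the snapshot problem for the fine
face `e` of `E`: on each element `K ⊆ ω_E` having `E` as a face, `κ⁻¹ ψ + ∇ p = 0`, `∇ · ψ` is
the compatible constant, `ψ · m` is the prescribed flux on `E` and `ψ · n = 0` on `∂K ∖ E`;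
the pressure `p` is in `L²` with mean zero on `K`. -/
def IsSnapshot (κ : Pt d → ℝ) (E : G.Face) (e : G.FineFace E) (ψ : VecL2 D) : Prop :=
  (∀ᵐ x ∂(volume.restrict D), x ∉ G.omega E → ψ x = 0) ∧
  ∃ p : Pt d → ℝ, MemLp p 2 (volume.restrict (G.omega E)) ∧
    ∀ K ∈ G.coarse.cells, E.1 ⊆ K →
      ∫ x in K, p x = 0 ∧
      IsWeakGrad (interior K) p (fun x => -((κ x)⁻¹ • ψ x)) ∧
      HasDivAndTrace K (frontier K) ψ (fun _ => G.divConst E e K)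
        (fun x => G.outSign E K * G.flux E e x)

/-- A choice of one field per coarse face and fine face on it. -/
abbrev SnapFamily := ∀ E : G.Face, G.FineFace E → VecL2 D

variable {G} (κ : Pt d → ℝ)

/-- The energy form over a set: `∫_S κ⁻¹ v · w`. -/
def energy (S : Set (Pt d)) (v w : VecL2 D) : ℝ :=
  ∫ x in S, (κ x)⁻¹ * inner ℝ (v x) (w x)

/-- The bilinear form `a(v, w) = ∫_D κ⁻¹ v · w`. -/
def form (v w : VecL2 D) : ℝ := energy κ D v w

/-- Local snapshot space. -/
def snapLocal (ψ : G.SnapFamily) (E : G.Face) : Submodule ℝ (VecL2 D) :=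
  Submodule.span ℝ (Set.range (ψ E))

/-- Global snapshot space. -/
def snap (ψ : G.SnapFamily) : Submodule ℝ (VecL2 D) := ⨆ E : G.Face, snapLocal ψ E

/-- The local snapshots with vanishing average normal flux through `E`. -/
def snap2 (ψ : G.SnapFamily) (E : G.Face) : Submodule ℝ (VecL2 D) :=
  Submodule.span ℝ {v | v ∈ snapLocal ψ E ∧
    ∃ g : Pt d → ℝ, G.HasNormalTrace E v g ∧ ∫ x in E.1, g x ∂(surf d) = 0}

/-- The restrictions to `ω_E` of the global snapshots (extended by zero). -/
def snapRestr (ψ : G.SnapFamily) (E : G.Face) : Submodule ℝ (VecL2 D) :=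
  Submodule.span ℝ {v | ∃ w ∈ snap ψ,
    ⇑v =ᵐ[volume.restrict D] (G.omega E).indicator w}

/-! ### The local spectral problem -/

/-- `w` is admissible for the minimization defining `𝓗_E v`: it is a restriction to `ω_E` of a
snapshot, and it has the same normal trace as `v` on `E`. -/
def Admissible (ψ : G.SnapFamily) (E : G.Face) (v w : VecL2 D) : Prop :=
  w ∈ snapRestr ψ E ∧ G.HasNormalTrace E (w - v : VecL2 D) 0

/-- The minimizer `𝓗_E v` of the energy over the admissible fields. -/
def minExt (ψ : G.SnapFamily) (E : G.Face) (v : VecL2 D) : VecL2 D :=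
  Classical.epsilon fun w => Admissible ψ E v w ∧
    ∀ w', Admissible ψ E v w' → energy κ (G.omega E) w w ≤ energy κ (G.omega E) w' w'

/-- `φ` is a basis of the zero-flux local snapshot space made of eigenfunctions of the local
spectral problem, with eigenvalues `ev` in ascending order (counted with multiplicity). -/
def IsSpectralBasis (ψ : G.SnapFamily) (E : G.Face) {n : ℕ}
    (φ : Basis (Fin n) ℝ (snap2 ψ E)) (ev : Fin n → ℝ) : Prop :=
  Monotone ev ∧ ∀ j, ∀ v ∈ snap2 ψ E,
    energy κ (G.omega E) (minExt κ ψ E (φ j)) (minExt κ ψ E v)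
      = ev j * energy κ (G.omega E) (φ j) v

/-- The local offline space, spanned by the first `J` eigenfunctions. -/
def sms {ψ : G.SnapFamily} {E : G.Face} {n : ℕ}
    (φ : Basis (Fin n) ℝ (snap2 ψ E)) (J : Fin n) : Submodule ℝ (VecL2 D) :=
  Submodule.span ℝ {v | ∃ j, j < J ∧ v = φ j}

/-- The `a`-orthogonal complement of the local offline space in the zero-flux local snapshot
space (the set on the right already is a subspace). -/
def smsCompl {ψ : G.SnapFamily} {E : G.Face} {n : ℕ}
    (φ : Basis (Fin n) ℝ (snap2 ψ E)) (J : Fin n) : Submodule ℝ (VecL2 D) :=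
  Submodule.span ℝ {v | v ∈ snap2 ψ E ∧ ∀ w ∈ sms φ J, form κ w v = 0}

/-! ### Matrices -/

/-- The stiffness matrix `(a(θ_j, θ_i))` of a family of fields grouped by the coarse faces. -/
def stiffness {r : G.Face → ℕ} (θ : ∀ E : G.Face, Fin (r E) → VecL2 D) :
    Matrix (Σ E : G.Face, Fin (r E)) (Σ E : G.Face, Fin (r E)) ℝ :=
  Matrix.of fun i j => form κ (θ j.1 j.2) (θ i.1 i.2)

/-- The block diagonal part of the stiffness matrix. -/
def blockJacobi {r : G.Face → ℕ} (θ : ∀ E : G.Face, Fin (r E) → VecL2 D) :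
    Matrix (Σ E : G.Face, Fin (r E)) (Σ E : G.Face, Fin (r E)) ℝ :=
  Matrix.blockDiagonal' (Matrix.blockDiag' (stiffness κ θ))

/-- The preconditioned matrix `A_pre⁻¹ A`. -/
def precond {r : G.Face → ℕ} (θ : ∀ E : G.Face, Fin (r E) → VecL2 D) :
    Matrix (Σ E : G.Face, Fin (r E)) (Σ E : G.Face, Fin (r E)) ℝ :=
  (blockJacobi κ θ)⁻¹ * stiffness κ θ

/-! ### The constants -/

variable (G) in
/-- The maximal number of coarse neighborhoods that contain a coarse element. -/
def M₁ : ℕ :=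
  G.coarse.cells.sup fun K => (Finset.univ.filter fun E : G.Face => K ⊆ G.omega E).card

/-- The maximal number, over the index `E`, of the indices `F` such that `W F` is not
`a`-orthogonal to `W E`. -/
def M₂ (W : G.Face → Submodule ℝ (VecL2 D)) : ℕ :=
  Finset.univ.sup fun E : G.Face =>
    (Finset.univ.filter fun F : G.Face => ¬ ∀ v ∈ W F, ∀ w ∈ W E, form κ v w = 0).card

end Grid

end CEMGMsFEM

end

/-! Coefficient vectors turn both matrices into energies: for `v = ∑ v_E` with `v_E` in the
complement space of the face `E`, the quadratic form of `A` is `a(v, v)` and that of `A_pre` is `∑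
a(v_E, v_E)`. Since `A_pre` is symmetric positive definite and `A` symmetric, the eigenvalues of
`A_pre⁻¹ A` are real and lie between any bounds for the quotient of these energies
(`eigenvalues_of_rayleigh_bounds`).

The upper bound `M₂` comes from expanding `a(v, v)` and estimating the interacting pairs by `2 a(u,
w) ≤ a(u, u) + a(w, w)` (`form_sum_le`).

The lower bound is a stable decomposition (`mul_sum_form_le`). The spectral problem gives `Λ a(v_E,
v_E) ≤ ‖𝓗_E v_E‖²` in the energy norm over `ω_E`, because `v_E` is orthogonal to the first
eigenfunctions (`eigenvalue_mul_form_le`). The restriction of the whole sum `v` to `ω_E` competes in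
the minimization defining `𝓗_E v_E`: the other components have no flux through `E`. Hence `Λ a(v_E,
v_E)` is at most the energy of `v` over `ω_E`, and summing over `E` counts almost every point at
most `M₁` times.

The geometric input is that a snapshot of `F` has zero weak normal trace on `E ≠ F`. Its prescribed
flux lives on `F`, and `E ∩ F` has zero surface measure because three convex bodies with disjoint
interiors share no `(d-1)`-dimensional set (`surf_inter_eq_zero`). -/

namespace CEMGMsFEM

/-! ### Bilinear forms: orthogonal representatives and Rayleigh quotients -/

section Abstract

variable {V : Type*} [AddCommGroup V] [Module ℝ V]

/-- Every coset of a finite-dimensional subspace on which `B` is positive definite contains a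
vector that is `B`-orthogonal to the subspace. -/
theorem exists_orthogonal_representative (B : LinearMap.BilinForm ℝ V) (N : Submodule ℝ V)
    [FiniteDimensional ℝ N] (hpos : ∀ u ∈ N, u ≠ 0 → 0 < B u u) (v : V) :
    ∃ w, w - v ∈ N ∧ ∀ u ∈ N, B w u = 0 := by
  -- Definiteness makes `N → N*` injective, hence bijective by dimension, so the functional `B v` on
  -- `N` is represented by some `u ∈ N`; then `w = v - u`.
  let L : N →ₗ[ℝ] Dual ℝ N := B.domRestrict₁₂ N N
  have hinj : Function.Injective L := by
    rw [← LinearMap.ker_eq_bot, LinearMap.ker_eq_bot']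
    intro u hu
    by_contra hne
    have h1 := hpos u u.2 (by simpa using hne)
    have h2 : L u u = 0 := by rw [hu]; rfl
    exact h1.ne' h2
  have hsurj : Function.Surjective L :=
    (LinearMap.injective_iff_surjective_of_finrank_eq_finrank
      (Subspace.dual_finrank_eq (K := ℝ) (V := N)).symm).1 hinj
  obtain ⟨u, hu⟩ := hsurj ((B v).domRestrict N)
  refine ⟨v - u, ?_, fun x hx => ?_⟩
  · have : v - (u : V) - v = -(u : V) := by abel
    rw [this]
    exact N.neg_mem u.2
  · have := congrArg (fun l : Dual ℝ N => l ⟨x, hx⟩) hu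
    have h : B u x = B v x := this
    rw [map_sub, LinearMap.sub_apply, h, sub_self]

/-- Lower Rayleigh bound for the vectors orthogonal to the first eigenvectors. The eigenvectors
need not be orthogonal inside an eigenspace. -/
theorem rayleigh_lower {n : ℕ} (B : LinearMap.BilinForm ℝ V)
    (hnonneg : ∀ u, 0 ≤ B u u) (φ : Fin n → V) (ev : Fin n → ℝ) (hmono : Monotone ev)
    (hcomm : ∀ i j, ev i * B (φ i) (φ j) = ev j * B (φ i) (φ j))
    (J : Fin n) (c : Fin n → ℝ) (horth : ∀ j, j < J → B (φ j) (∑ i, c i • φ i) = 0) :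
    ev J * B (∑ i, c i • φ i) (∑ i, c i • φ i)
      ≤ ∑ j, c j * (ev j * B (φ j) (∑ i, c i • φ i)) := by
  set v := ∑ i, c i • φ i with hv
  -- The weights are chosen so that the gap between the two sides is exactly `B u u ≥ 0`. The square
  -- root of a negative number is `0`, which removes the indices below `J`; there `horth` makes the
  -- other side of `key` vanish too.
  let t : Fin n → ℝ := fun j => √(ev j - ev J)
  let u := ∑ i, (t i * c i) • φ i
  have key : ∀ j, (ev j - ev J) * B (φ j) v = t j * B (φ j) u := by
    intro j
    by_cases hj : j < J
    · have : t j = 0 := Real.sqrt_eq_zero_of_nonpos (by linarith [hmono hj.le])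
      rw [horth j hj, this]; ring
    · have hsq : t j * t j = ev j - ev J :=
        Real.mul_self_sqrt (by linarith [hmono (not_lt.1 hj)])
      simp only [hv, u, map_sum, map_smul, smul_eq_mul, Finset.mul_sum]
      refine Finset.sum_congr rfl fun i _ => ?_
      -- Only pairs with equal eigenvalues interact, so `t i` may be replaced by `t j`.
      by_cases h0 : B (φ j) (φ i) = 0
      · simp [h0]
      · have he : ev j = ev i := mul_right_cancel₀ h0 (hcomm j i)
        have ht : t i = t j := by simp [t, he]
        rw [ht, ← hsq]; ring
  have expand : ∀ (a : Fin n → ℝ) (w : V), B (∑ i, a i • φ i) w = ∑ i, a i * B (φ i) w := by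
    simp
  have hBv : B v v = ∑ j, c j * B (φ j) v := expand c v
  have hBu : B u u = ∑ j, t j * c j * B (φ j) u := expand _ u
  have hdiff : ∑ j, c j * (ev j * B (φ j) v) - ev J * B v v = B u u := by
    rw [hBv, hBu, Finset.mul_sum, ← Finset.sum_sub_distrib]
    refine Finset.sum_congr rfl fun j _ => ?_
    linear_combination c j * key j
  linarith [hnonneg u]

end Abstract

/-! ### Eigenvalues of a symmetric pencil -/

section GeneralizedEigenvalues

open Matrix

variable {σ : Type*} [Fintype σ]

theorem re_mulVec_map_ofReal (A : Matrix σ σ ℝ) (x : σ → ℂ) :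
    (fun i => ((A.map (fun t : ℝ => (t : ℂ)) *ᵥ x) i).re) = A *ᵥ fun i => (x i).re := by
  ext i; simp [mulVec, dotProduct]

theorem im_mulVec_map_ofReal (A : Matrix σ σ ℝ) (x : σ → ℂ) :
    (fun i => ((A.map (fun t : ℝ => (t : ℂ)) *ᵥ x) i).im) = A *ᵥ fun i => (x i).im := by
  ext i; simp [mulVec, dotProduct]

theorem dotProduct_mulVec_comm_of_isSymm {A : Matrix σ σ ℝ} (hA : A.IsSymm) (x y : σ → ℝ) :
    x ⬝ᵥ A *ᵥ y = y ⬝ᵥ A *ᵥ x := by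
  rw [dotProduct_mulVec, ← mulVec_transpose, hA.eq, dotProduct_comm]

/-- Eigenvalues of `P⁻¹ A` for symmetric `A` and symmetric positive definite `P`: they are real,
and they lie between the bounds of the generalized Rayleigh quotient. -/
theorem eigenvalues_of_rayleigh_bounds [DecidableEq σ] [Nonempty σ] {A P : Matrix σ σ ℝ}
    (hA : A.IsSymm) (hP : P.IsSymm) (hpos : ∀ x : σ → ℝ, x ≠ 0 → 0 < x ⬝ᵥ P *ᵥ x)
    {l m : ℝ} (hl : ∀ x : σ → ℝ, l * (x ⬝ᵥ P *ᵥ x) ≤ x ⬝ᵥ A *ᵥ x)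
    (hm : ∀ x : σ → ℝ, x ⬝ᵥ A *ᵥ x ≤ m * (x ⬝ᵥ P *ᵥ x)) :
    IsUnit P ∧
    (∀ z : ℂ, Module.End.HasEigenvalue
      ((P⁻¹ * A).map (fun x : ℝ => (x : ℂ))).mulVecLin z → z.im = 0) ∧
    ∃ μmin μmax : ℝ,
      IsLeast {μ : ℝ | Module.End.HasEigenvalue (P⁻¹ * A).mulVecLin μ} μmin ∧
      IsGreatest {μ : ℝ | Module.End.HasEigenvalue (P⁻¹ * A).mulVecLin μ} μmax ∧
      l ≤ μmin ∧ μmin ≤ μmax ∧ μmax ≤ m := by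
  have hunit : IsUnit P := by
    rw [← mulVec_injective_iff_isUnit, ← coe_mulVecLin, ← LinearMap.ker_eq_bot,
      LinearMap.ker_eq_bot']
    intro x hx
    by_contra hne
    have := hpos x hne
    rw [show P *ᵥ x = 0 from hx, dotProduct_zero] at this
    exact this.false
  have hdet : IsUnit P.det := (isUnit_iff_isUnit_det _).1 hunit
  have hgen : ∀ (μ : ℝ) (x : σ → ℝ), (P⁻¹ * A) *ᵥ x = μ • x → A *ᵥ x = μ • (P *ᵥ x) := by
    intro μ x hx
    have h := congrArg (fun y => P *ᵥ y) hx
    simp only [mulVec_mulVec, mulVec_smul] at h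
    rwa [← mul_assoc, mul_nonsing_inv _ hdet, one_mul] at h
  have hparts : ∀ (z : ℂ) (x : σ → ℂ),
      (P⁻¹ * A).map (fun x : ℝ => (x : ℂ)) *ᵥ x = z • x →
      (P⁻¹ * A) *ᵥ (fun i => (x i).re) = (fun i => z.re * (x i).re - z.im * (x i).im) ∧
      (P⁻¹ * A) *ᵥ (fun i => (x i).im) = (fun i => z.re * (x i).im + z.im * (x i).re) := by
    intro z x hx
    rw [← re_mulVec_map_ofReal, ← im_mulVec_map_ofReal, hx]
    constructor <;> ext i <;> simp
  have hreal : ∀ z : ℂ, Module.End.HasEigenvalue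
      ((P⁻¹ * A).map (fun x : ℝ => (x : ℂ))).mulVecLin z → z.im = 0 := by
    intro z hz
    obtain ⟨x, hx⟩ := hz.exists_hasEigenvector
    have hx1 : (P⁻¹ * A).map (fun x : ℝ => (x : ℂ)) *ᵥ x = z • x := hx.apply_eq_smul
    obtain ⟨hr, hi⟩ := hparts z x hx1
    set a : σ → ℝ := fun i => (x i).re with ha
    set b : σ → ℝ := fun i => (x i).im with hb
    have hab : a ≠ 0 ∨ b ≠ 0 := by
      by_contra! h
      apply hx.2
      ext i
      exact Complex.ext (congrFun h.1 i) (congrFun h.2 i)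
    have lift : ∀ y w : σ → ℝ, (P⁻¹ * A) *ᵥ y = w → A *ᵥ y = P *ᵥ w := by
      rintro y w rfl
      rw [mulVec_mulVec, ← mul_assoc, mul_nonsing_inv _ hdet, one_mul]
    have hr' : A *ᵥ a = z.re • P *ᵥ a - z.im • P *ᵥ b := by
      rw [lift _ _ hr, ← mulVec_smul, ← mulVec_smul, ← mulVec_sub]; rfl
    have hi' : A *ᵥ b = z.re • P *ᵥ b + z.im • P *ᵥ a := by
      rw [lift _ _ hi, ← mulVec_smul, ← mulVec_smul, ← mulVec_add]; rfl
    have h1 : b ⬝ᵥ A *ᵥ a = a ⬝ᵥ A *ᵥ b := dotProduct_mulVec_comm_of_isSymm hA b a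
    have h2 : b ⬝ᵥ P *ᵥ a = a ⬝ᵥ P *ᵥ b := dotProduct_mulVec_comm_of_isSymm hP b a
    -- Symmetry of `A` gives `b·Aa = a·Ab`; after substitution only `z.im (a·Pa + b·Pb) = 0`
    -- survives.
    rw [hr', hi'] at h1
    simp only [dotProduct_sub, dotProduct_add, dotProduct_smul, smul_eq_mul, h2] at h1
    have hnn : ∀ y : σ → ℝ, 0 ≤ y ⬝ᵥ P *ᵥ y := fun y => by
      by_cases hy : y = 0
      · simp [hy]
      · exact (hpos y hy).le
    have hsum : 0 < a ⬝ᵥ P *ᵥ a + b ⬝ᵥ P *ᵥ b := by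
      rcases hab with h | h
      · linarith [hpos a h, hnn b]
      · linarith [hpos b h, hnn a]
    have : z.im * (a ⬝ᵥ P *ᵥ a + b ⬝ᵥ P *ᵥ b) = 0 := by linear_combination -h1
    exact (mul_eq_zero.1 this).resolve_right hsum.ne'
  refine ⟨hunit, hreal, ?_⟩
  let S := {μ : ℝ | Module.End.HasEigenvalue (P⁻¹ * A).mulVecLin μ}
  have hfin : S.Finite := Module.End.finite_hasEigenvalue _
  -- A complex eigenvalue exists because the index type is nonempty. It is real, so a nonvanishing
  -- real or imaginary part of its eigenvector is a real eigenvector.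
  have hne : S.Nonempty := by
    obtain ⟨z, hz⟩ := Module.End.exists_eigenvalue
      ((P⁻¹ * A).map (fun x : ℝ => (x : ℂ))).mulVecLin
    have him := hreal z hz
    obtain ⟨x, hx⟩ := hz.exists_hasEigenvector
    obtain ⟨hr, hi⟩ := hparts z x hx.apply_eq_smul
    have mk : ∀ y : σ → ℝ, y ≠ 0 → (P⁻¹ * A) *ᵥ y = z.re • y → z.re ∈ S := fun y hy h =>
      Module.End.hasEigenvalue_of_hasEigenvector (x := y)
        (Module.End.hasEigenvector_iff.2 ⟨Module.End.mem_eigenspace_iff.2 h, hy⟩)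
    refine ⟨z.re, ?_⟩
    by_cases ha : (fun i => (x i).re) = 0
    · refine mk (fun i => (x i).im) (fun hb => hx.2 ?_) ?_
      · ext i
        exact Complex.ext (congrFun ha i) (congrFun hb i)
      · rw [hi]; ext i; simp [him]
    · refine mk _ ha ?_
      rw [hr]; ext i; simp [him]
  have hquot : ∀ μ ∈ S, l ≤ μ ∧ μ ≤ m := by
    intro μ hμ
    obtain ⟨x, hx⟩ := Module.End.HasEigenvalue.exists_hasEigenvector hμ
    have h1 : A *ᵥ x = μ • (P *ᵥ x) := hgen μ x hx.apply_eq_smul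
    have hp := hpos x hx.2
    have h2 := hl x
    have h3 := hm x
    rw [h1, dotProduct_smul, smul_eq_mul] at h2 h3
    exact ⟨le_of_mul_le_mul_right h2 hp, le_of_mul_le_mul_right h3 hp⟩
  obtain ⟨μ₁, h₁⟩ := hfin.exists_minimal hne
  obtain ⟨μ₂, h₂⟩ := hfin.exists_maximal hne
  have hle : IsLeast S μ₁ := ⟨h₁.1, fun x hx => (le_total μ₁ x).elim id fun h => h₁.2 hx h⟩
  have hge : IsGreatest S μ₂ := ⟨h₂.1, fun x hx => (le_total x μ₂).elim id fun h => h₂.2 hx h⟩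
  exact ⟨μ₁, μ₂, hle, hge, (hquot _ hle.1).1, hle.2 hge.1, (hquot _ hge.1).2⟩

end GeneralizedEigenvalues

/-! ### Separation of convex bodies and dimension of common faces -/

section Convex

variable {V : Type*} [NormedAddCommGroup V] [NormedSpace ℝ V]

/-- Convex bodies with disjoint interiors are separated by a hyperplane. -/
theorem exists_separating_functional {A B : Set V} (hA : Convex ℝ A) (hB : Convex ℝ B)
    (hAi : (interior A).Nonempty) (hBi : (interior B).Nonempty)
    (hAB : Disjoint (interior A) (interior B)) :
    ∃ (f : V →L[ℝ] ℝ) (c : ℝ), f ≠ 0 ∧ (∀ x ∈ A, f x ≤ c) ∧ ∀ x ∈ B, c ≤ f x := by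
  obtain ⟨f, c, h1, h2⟩ := geometric_hahn_banach_open_open hA.interior isOpen_interior
    hB.interior isOpen_interior hAB
  refine ⟨f, c, ?_, ?_, ?_⟩
  · rintro rfl
    obtain ⟨x, hx⟩ := hAi
    obtain ⟨y, hy⟩ := hBi
    have := h1 x hx
    have := h2 y hy
    simp at *
    linarith
  · intro x hx
    have hx' : x ∈ closure (interior A) := by
      rw [hA.closure_interior_eq_closure_of_nonempty_interior hAi]; exact subset_closure hx
    exact closure_minimal (fun y hy => (h1 y hy).le) (isClosed_le f.continuous continuous_const) hx'
  · intro x hx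
    have hx' : x ∈ closure (interior B) := by
      rw [hB.closure_interior_eq_closure_of_nonempty_interior hBi]; exact subset_closure hx
    exact closure_minimal (fun y hy => (h2 y hy).le) (isClosed_le continuous_const f.continuous) hx'

/-- A nonzero linear functional is not constant on a set with nonempty interior. -/
theorem not_forall_eq_of_nonempty_interior {A : Set V} (hAi : (interior A).Nonempty)
    {f : V →L[ℝ] ℝ} (hf : f ≠ 0) (c : ℝ) : ¬ ∀ x ∈ A, f x = c := by
  intro h
  have hopen := f.isOpenMap_of_ne_zero hf _ (isOpen_interior (s := A))
  obtain ⟨x, hx⟩ := hAi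
  have hsub : f '' interior A ⊆ {c} := by
    rintro _ ⟨y, hy, rfl⟩
    exact h y (interior_subset hy)
  have : f '' interior A = {c} := by
    refine hsub.antisymm ?_
    rintro _ rfl
    exact ⟨x, hx, h x (interior_subset hx)⟩
  rw [this] at hopen
  exact not_isOpen_singleton c hopen

variable [FiniteDimensional ℝ V]

/-- Three convex bodies with pairwise disjoint interiors have no hyperplane piece in common. -/
theorem finrank_vectorSpan_lt_of_subset_three {A B C F : Set V}
    (hA : Convex ℝ A) (hB : Convex ℝ B) (hC : Convex ℝ C) (hAi : (interior A).Nonempty)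
    (hBi : (interior B).Nonempty) (hCi : (interior C).Nonempty)
    (hAB : Disjoint (interior A) (interior B)) (hAC : Disjoint (interior A) (interior C))
    (hBC : Disjoint (interior B) (interior C)) (hFA : F ⊆ A) (hFB : F ⊆ B) (hFC : F ⊆ C)
    (hF : F.Nonempty) :
    finrank ℝ (vectorSpan ℝ F) + 1 < finrank ℝ V := by
  obtain ⟨f, a, hf, hfA, hfB⟩ := exists_separating_functional hA hB hAi hBi hAB
  obtain ⟨g, b, hg, hgA, hgC⟩ := exists_separating_functional hA hC hAi hCi hAC
  obtain ⟨h, c, hh, hhB, hhC⟩ := exists_separating_functional hB hC hBi hCi hBC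
  by_contra! hdim
  obtain ⟨x₀, hx₀⟩ := hF
  have e1 : ∀ x ∈ F, f x = a := fun x hx => le_antisymm (hfA x (hFA hx)) (hfB x (hFB hx))
  have e2 : ∀ x ∈ F, g x = b := fun x hx => le_antisymm (hgA x (hFA hx)) (hgC x (hFC hx))
  have e3 : ∀ x ∈ F, h x = c := fun x hx => le_antisymm (hhB x (hFB hx)) (hhC x (hFC hx))
  have hker : ∀ (k : V →L[ℝ] ℝ) (s : ℝ), (∀ x ∈ F, k x = s) →
      vectorSpan ℝ F ≤ LinearMap.ker (k : V →ₗ[ℝ] ℝ) := by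
    intro k s hk
    rw [vectorSpan, Submodule.span_le]
    rintro _ ⟨x, hx, y, hy, rfl⟩
    simp [hk x hx, hk y hy]
  have hrank : ∀ k : V →L[ℝ] ℝ, k ≠ 0 →
      finrank ℝ (LinearMap.ker (k : V →ₗ[ℝ] ℝ)) + 1 = finrank ℝ V := by
    intro k hk
    exact Module.Dual.finrank_ker_add_one_of_ne_zero
      (f := (k : V →ₗ[ℝ] ℝ)) (fun h0 => hk (by ext x; exact congrArg (fun l => l x) h0))
  -- If `F` had dimension at least `d - 1`, its direction space would be the kernel of every
  -- separating functional. All three hyperplanes would then coincide, and the functionals would be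
  -- proportional.
  have hkf : vectorSpan ℝ F = LinearMap.ker (f : V →ₗ[ℝ] ℝ) :=
    Submodule.eq_of_le_of_finrank_le (hker f a e1) (by have := hrank f hf; omega)
  have prop : ∀ (k : V →L[ℝ] ℝ) (s : ℝ), k ≠ 0 → (∀ x ∈ F, k x = s) →
      ∃ t : ℝ, t ≠ 0 ∧ ∀ x, k x - s = t * (f x - a) := by
    intro k s hk0 hk
    have hle : LinearMap.ker (f : V →ₗ[ℝ] ℝ) ≤ LinearMap.ker (k : V →ₗ[ℝ] ℝ) := hkf ▸ hker k s hk
    obtain ⟨y, hy⟩ : ∃ y, f y ≠ 0 := by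
      by_contra! h0
      exact hf (by ext x; simpa using h0 x)
    have hlin : ∀ x, k x = k y / f y * f x := by
      intro x
      have hm : x - (f x / f y) • y ∈ LinearMap.ker (f : V →ₗ[ℝ] ℝ) := by
        simp [hy]
      have := hle hm
      simp only [LinearMap.mem_ker, map_sub, map_smul, ContinuousLinearMap.coe_coe, smul_eq_mul]
        at this
      rw [sub_eq_zero.1 this]
      field_simp
    refine ⟨k y / f y, ?_, fun x => ?_⟩
    · intro h0
      apply hk0
      ext x
      rw [hlin x, h0]
      simp
    · rw [← hk x₀ hx₀, ← e1 x₀ hx₀, hlin x, hlin x₀]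
      ring
  obtain ⟨t, ht, hgt⟩ := prop g b hg e2
  obtain ⟨s, hs, hst⟩ := prop h c hh e3
  -- With a single hyperplane, two of the three bodies lie on the same side although it separates
  -- them. One of those two is then contained in the hyperplane, against its nonempty interior; the
  -- signs of `t` and `s` decide which.
  rcases ht.lt_or_gt with ht | ht
  · refine not_forall_eq_of_nonempty_interior hAi hf a fun x hx => ?_
    have h1 := hgA x hx
    have h2 := hgt x
    have h3 := hfA x hx
    nlinarith
  · have hfC : ∀ x ∈ C, a ≤ f x := by
      intro x hx
      have h1 := hgC x hx
      have h2 := hgt x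
      by_contra! h3
      nlinarith
    rcases hs.lt_or_gt with hs | hs
    · refine not_forall_eq_of_nonempty_interior hCi hf a fun x hx => ?_
      have h1 := hhC x hx
      have h2 := hst x
      have h3 := hfC x hx
      nlinarith
    · refine not_forall_eq_of_nonempty_interior hBi hf a fun x hx => ?_
      have h1 := hhB x hx
      have h2 := hst x
      have h3 := hfB x hx
      nlinarith

end Convex

/-- Sets of dimension less than `k` are null for the `k`-dimensional Hausdorff measure. -/
theorem euclideanHausdorffMeasure_eq_zero_of_finrank_lt {V : Type*} [NormedAddCommGroup V]
    [InnerProductSpace ℝ V] [FiniteDimensional ℝ V] [MeasurableSpace V] [BorelSpace V]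
    {F : Set V} {k : ℕ} (hF : finrank ℝ (vectorSpan ℝ F) < k) :
    Measure.euclideanHausdorffMeasure k F = 0 := by
  rcases F.eq_empty_or_nonempty with rfl | ⟨x₀, hx₀⟩
  · simp
  have hsub : F ⊆ Set.range fun v : vectorSpan ℝ F => (v : V) + x₀ := by
    intro x hx
    exact ⟨⟨x - x₀, vsub_mem_vectorSpan ℝ hx hx₀⟩, by simp⟩
  -- `F` lies in a smooth image of its direction space, and smooth maps do not raise the Hausdorff
  -- dimension.
  have hdim : dimH F < (k : NNReal) := by
    refine (dimH_mono hsub).trans_lt (lt_of_le_of_lt (ContDiff.dimH_range_le ?_) ?_)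
    · exact ((vectorSpan ℝ F).subtypeL.contDiff).add contDiff_const
    · simpa using hF
  rw [Measure.euclideanHausdorffMeasure_def, Measure.smul_apply]
  have := hausdorffMeasure_of_dimH_lt hdim
  simp at this
  simp [this]

/-! ### Null sets of a mesh -/

namespace Mesh

variable {d : ℕ} {D : Set (Pt d)}

theorem isOpen_domain (T : Mesh D) : IsOpen D := T.interior_union_eq ▸ isOpen_interior

variable {T : Mesh D}

theorem convex_of_mem {K : Set (Pt d)} (hK : K ∈ T.cells) : Convex ℝ K := by
  obtain ⟨s, rfl⟩ := T.polytope K hK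
  exact convex_convexHull ℝ _

theorem isCompact_of_mem {K : Set (Pt d)} (hK : K ∈ T.cells) : IsCompact K := by
  obtain ⟨s, rfl⟩ := T.polytope K hK
  exact s.finite_toSet.isCompact_convexHull (𝕜 := ℝ)

theorem measurableSet_of_mem {K : Set (Pt d)} (hK : K ∈ T.cells) : MeasurableSet K :=
  (isCompact_of_mem hK).isClosed.measurableSet

theorem ae_notMem_frontier {K : Set (Pt d)} (hK : K ∈ T.cells) :
    ∀ᵐ x : Pt d, x ∉ frontier K :=
  measure_eq_zero_iff_ae_notMem.1 ((convex_of_mem hK).addHaar_frontier volume)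

theorem subset_closure_of_mem {K : Set (Pt d)} (hK : K ∈ T.cells) : K ⊆ closure D := by
  rw [← T.union_eq]
  exact Set.subset_biUnion_of_mem (u := fun K : Set (Pt d) => K) hK

theorem ae_notMem_frontiers (T : Mesh D) : ∀ᵐ x : Pt d, ∀ K ∈ T.cells, x ∉ frontier K :=
  (Finset.eventually_all T.cells).2 fun _ hK => ae_notMem_frontier hK

theorem mem_interior_of_notMem_frontier {K : Set (Pt d)} {x : Pt d} (hx : x ∈ K)
    (hf : x ∉ frontier K) : x ∈ interior K := by
  by_contra h
  exact hf ⟨subset_closure hx, h⟩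

/-- The boundary of an open set may have positive measure; here almost every point of `closure D` is
interior to an element, hence in `D`. This reconciles fields given on `D` with elements that are
only contained in `closure D`. -/
theorem ae_domain_eq_closure (T : Mesh D) : D =ᵐ[volume] closure D := by
  filter_upwards [T.ae_notMem_frontiers] with x hx
  refine propext ⟨fun h => subset_closure h, fun h => ?_⟩
  rw [← T.union_eq] at h
  obtain ⟨K, hK, hxK⟩ := Set.mem_iUnion₂.1 h
  change x ∈ D
  rw [← T.interior_union_eq]
  exact interior_mono (Set.subset_biUnion_of_mem (u := fun K : Set (Pt d) => K) hK)
    (mem_interior_of_notMem_frontier hxK (hx K hK))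

theorem restrict_closure (T : Mesh D) : (volume : Measure (Pt d)).restrict (closure D) = volume.restrict D :=
  (Measure.restrict_congr_set T.ae_domain_eq_closure).symm

theorem restrict_le (T : Mesh D) {S : Set (Pt d)} (hS : S ⊆ closure D) :
    (volume : Measure (Pt d)).restrict S ≤ volume.restrict D :=
  T.restrict_closure ▸ Measure.restrict_mono_set _ hS

/-- Almost every point lies in at most one element. -/
theorem ae_unique_cell (T : Mesh D) :
    ∀ᵐ x : Pt d, ∀ K ∈ T.cells, ∀ K' ∈ T.cells, x ∈ K → x ∈ K' → K = K' := by
  filter_upwards [T.ae_notMem_frontiers] with x hx K hK K' hK' h h'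
  by_contra hne
  exact Set.disjoint_left.1 (T.disjoint_interior K hK K' hK' hne)
    (mem_interior_of_notMem_frontier h (hx K hK))
    (mem_interior_of_notMem_frontier h' (hx K' hK'))

theorem exists_of_mem_faces {E : Set (Pt d)} (hE : E ∈ T.faces) :
    ∃ K ∈ T.cells, ∃ K' ∈ T.cells, K ≠ K' ∧ K ∩ K' = E := by
  simp only [faces, Finset.mem_filter, Finset.mem_image, Finset.mem_offDiag, Prod.exists] at hE
  obtain ⟨⟨K, K', ⟨h1, h2, h3⟩, h4⟩, -⟩ := hE
  exact ⟨K, h1, K', h2, h3, h4⟩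

/-- Distinct faces intersect in a set of surface measure zero. -/
theorem surf_inter_eq_zero {E F : Set (Pt d)} (hE : E ∈ T.faces) (hF : F ∈ T.faces)
    (hEF : E ≠ F) : surf d (E ∩ F) = 0 := by
  obtain ⟨A, hA, B, hB, hAB, rfl⟩ := exists_of_mem_faces hE
  obtain ⟨A', hA', B', hB', hAB', rfl⟩ := exists_of_mem_faces hF
  set S := A ∩ B ∩ (A' ∩ B') with hS
  rcases S.eq_empty_or_nonempty with h0 | h0
  · rw [h0]; exact measure_empty
  have key : ∀ C ∈ T.cells, C ≠ A → C ≠ B → S ⊆ C → surf d S = 0 := by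
    intro C hC hCA hCB hSC
    apply euclideanHausdorffMeasure_eq_zero_of_finrank_lt
    have := finrank_vectorSpan_lt_of_subset_three (F := S) (convex_of_mem hA) (convex_of_mem hB)
      (convex_of_mem hC) (T.nonempty_interior A hA) (T.nonempty_interior B hB)
      (T.nonempty_interior C hC) (T.disjoint_interior A hA B hB hAB)
      (T.disjoint_interior A hA C hC hCA.symm) (T.disjoint_interior B hB C hC hCB.symm)
      (fun x hx => hx.1.1) (fun x hx => hx.1.2) hSC h0
    rw [finrank_euclideanSpace_fin] at this
    omega
  -- The unordered pairs `{A, B}` and `{A', B'}` differ, so one of `A'`, `B'` is a third element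
  -- containing the intersection.
  by_cases h1 : A' = A
  · by_cases h2 : B' = B
    · exact absurd (by rw [h1, h2]) hEF
    · exact key B' hB' (fun h => hAB' (h1.trans h.symm)) h2 (fun x hx => hx.2.2)
  · by_cases h2 : A' = B
    · by_cases h3 : B' = A
      · exact absurd (by rw [h2, h3, Set.inter_comm]) hEF
      · exact key B' hB' h3 (fun h => hAB' (h2.trans h.symm)) (fun x hx => hx.2.2)
    · exact key A' hA' h1 h2 (fun x hx => hx.2.1)

end Mesh

end CEMGMsFEM

/-! ### Weighted energies on `L²` fields -/

noncomputable section

namespace CEMGMsFEM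

variable {d : ℕ} {D : Set (Pt d)}

/-- The coefficient is measurable and bounded between positive constants on `D`. -/
structure BoundedCoeff (D : Set (Pt d)) (κ : Pt d → ℝ) (κmin κmax : ℝ) : Prop where
  aemeasurable : AEMeasurable κ (volume.restrict D)
  pos : 0 < κmin
  bound : ∀ᵐ x ∂(volume.restrict D), κmin ≤ κ x ∧ κ x ≤ κmax

/-- The fields that vanish outside of `S`. -/
def supported (D S : Set (Pt d)) : Submodule ℝ (VecL2 D) where
  carrier := {v | ∀ᵐ x ∂(volume.restrict D), x ∉ S → v x = 0}
  zero_mem' := by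
    filter_upwards [Lp.coeFn_zero (Pt d) 2 (volume.restrict D)] with x hx _
    rw [hx]; rfl
  add_mem' := by
    intro v w hv hw
    filter_upwards [hv, hw, Lp.coeFn_add v w] with x h1 h2 h3 hx
    rw [h3, Pi.add_apply, h1 hx, h2 hx, add_zero]
  smul_mem' := by
    intro c v hv
    filter_upwards [hv, Lp.coeFn_smul c v] with x h1 h3 hx
    rw [h3, Pi.smul_apply, h1 hx, smul_zero]

theorem mem_supported {S : Set (Pt d)} {v : VecL2 D} :
    v ∈ supported D S ↔ ∀ᵐ x ∂(volume.restrict D), x ∉ S → v x = 0 := Iff.rfl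

/-- Restriction to a measurable set, followed by extension by zero. -/
def cutoff (D : Set (Pt d)) {S : Set (Pt d)} (hS : MeasurableSet S) :
    VecL2 D →ₗ[ℝ] VecL2 D where
  toFun v := ((Lp.memLp v).indicator hS).toLp _
  map_add' v w := by
    rw [← MemLp.toLp_add]
    refine MemLp.toLp_congr _ _ ?_
    filter_upwards [Lp.coeFn_add v w] with x hx
    rw [← Set.indicator_add', Set.indicator_apply, Set.indicator_apply, hx]
  map_smul' c v := by
    rw [RingHom.id_apply, ← MemLp.toLp_const_smul]
    refine MemLp.toLp_congr _ _ ?_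
    filter_upwards [Lp.coeFn_smul c v] with x hx
    by_cases h : x ∈ S
    · rw [Pi.smul_apply, Set.indicator_of_mem h, Set.indicator_of_mem h, hx, Pi.smul_apply]
    · rw [Pi.smul_apply, Set.indicator_of_notMem h, Set.indicator_of_notMem h, smul_zero]

theorem coeFn_cutoff {S : Set (Pt d)} (hS : MeasurableSet S) (v : VecL2 D) :
    ((cutoff D hS v : VecL2 D) : Pt d → Pt d) =ᵐ[volume.restrict D]
      S.indicator (v : Pt d → Pt d) := by
  have h : cutoff D hS v = ((Lp.memLp v).indicator hS).toLp _ := rfl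
  rw [h]
  exact MemLp.coeFn_toLp _

namespace BoundedCoeff

variable {κ : Pt d → ℝ} {κmin κmax : ℝ} {S : Set (Pt d)}

theorem integrableOn_energy (hκ : BoundedCoeff D κ κmin κmax) (T : Mesh D) (hS : S ⊆ closure D)
    (v w : VecL2 D) : IntegrableOn (fun x => (κ x)⁻¹ * inner ℝ (v x) (w x)) S := by
  refine Integrable.mono_measure ?_ (T.restrict_le hS)
  refine Integrable.bdd_mul (c := κmin⁻¹) (L2.integrable_inner v w)
    hκ.aemeasurable.inv.aestronglyMeasurable ?_
  filter_upwards [hκ.bound] with x hx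
  rw [Real.norm_eq_abs, abs_inv, abs_of_pos (hκ.pos.trans_le hx.1)]
  exact inv_anti₀ hκ.pos hx.1

/-- The energy over `S` as a bilinear form. -/
def energyForm (hκ : BoundedCoeff D κ κmin κmax) (T : Mesh D) (hS : S ⊆ closure D) :
    LinearMap.BilinForm ℝ (VecL2 D) :=
  have hac : ∀ {p : Pt d → Prop}, (∀ᵐ x ∂(volume.restrict D), p x) →
      ∀ᵐ x ∂(volume.restrict S), p x := fun h => ae_mono (T.restrict_le hS) h
  LinearMap.mk₂ ℝ (Grid.energy κ S)
    (fun v v' w => by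
      rw [Grid.energy, Grid.energy, Grid.energy, ← integral_add
        (hκ.integrableOn_energy T hS v w) (hκ.integrableOn_energy T hS v' w)]
      refine integral_congr_ae ?_
      filter_upwards [hac (Lp.coeFn_add v v')] with x hx
      rw [hx, Pi.add_apply, inner_add_left, mul_add])
    (fun c v w => by
      rw [Grid.energy, Grid.energy, smul_eq_mul, ← integral_const_mul]
      refine integral_congr_ae ?_
      filter_upwards [hac (Lp.coeFn_smul c v)] with x hx
      rw [hx, Pi.smul_apply, real_inner_smul_left]
      ring)
    (fun v w w' => by
      rw [Grid.energy, Grid.energy, Grid.energy, ← integral_add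
        (hκ.integrableOn_energy T hS v w) (hκ.integrableOn_energy T hS v w')]
      refine integral_congr_ae ?_
      filter_upwards [hac (Lp.coeFn_add w w')] with x hx
      rw [hx, Pi.add_apply, inner_add_right, mul_add])
    (fun c v w => by
      rw [Grid.energy, Grid.energy, smul_eq_mul, ← integral_const_mul]
      refine integral_congr_ae ?_
      filter_upwards [hac (Lp.coeFn_smul c w)] with x hx
      rw [hx, Pi.smul_apply, real_inner_smul_right]
      ring)

theorem energy_integrand_nonneg (hκ : BoundedCoeff D κ κmin κmax) (v : VecL2 D) :
    ∀ᵐ x ∂(volume.restrict D), 0 ≤ (κ x)⁻¹ * inner ℝ (v x) (v x) := by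
  filter_upwards [hκ.bound] with x hx
  exact mul_nonneg (inv_nonneg.2 (hκ.pos.le.trans hx.1)) real_inner_self_nonneg

theorem energy_nonneg (hκ : BoundedCoeff D κ κmin κmax) (T : Mesh D) (hS : S ⊆ closure D)
    (v : VecL2 D) : 0 ≤ Grid.energy κ S v v :=
  integral_nonneg_of_ae (ae_mono (T.restrict_le hS) (hκ.energy_integrand_nonneg v))

theorem form_pos (hκ : BoundedCoeff D κ κmin κmax) (T : Mesh D) {v : VecL2 D} (hv : v ≠ 0) :
    0 < Grid.form κ v v := by
  refine lt_of_le_of_ne (hκ.energy_nonneg T subset_closure v) fun h => hv ?_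
  have h0 := (integral_eq_zero_iff_of_nonneg_ae (hκ.energy_integrand_nonneg v)
    (hκ.integrableOn_energy T subset_closure v v)).1 h.symm
  rw [Lp.eq_zero_iff_ae_eq_zero]
  filter_upwards [h0, hκ.bound] with x h1 h2
  simpa [(hκ.pos.trans_le h2.1).ne'] using h1

end BoundedCoeff

theorem Grid.energy_comm (κ : Pt d → ℝ) (S : Set (Pt d)) (v w : VecL2 D) :
    energy κ S v w = energy κ S w v := by
  simp only [energy, real_inner_comm]

/-- Support of one argument suffices. This carries `a`-orthogonality over to the spectral problem,
which is posed on `ω_E`. -/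
theorem energy_eq_form_of_mem_supported (T : Mesh D) (κ : Pt d → ℝ) {S : Set (Pt d)}
    (hS : S ⊆ closure D) {v : VecL2 D} (hv : v ∈ supported D S) (w : VecL2 D) :
    Grid.energy κ S v w = Grid.form κ v w := by
  rw [Grid.form, Grid.energy, Grid.energy, setIntegral_congr_set T.ae_domain_eq_closure]
  refine (setIntegral_eq_of_subset_of_ae_sdiff_eq_zero
    isClosed_closure.measurableSet.nullMeasurableSet hS ?_).symm
  rw [mem_supported, ae_restrict_iff' T.isOpen_domain.measurableSet] at hv
  filter_upwards [hv, T.ae_domain_eq_closure.mem_iff] with x hx hD h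
  simp [hx (hD.2 h.1) h.2]

/-! ### Fields without normal flux -/

theorem continuous_gradient {q : Pt d → ℝ} (hq : ContDiff ℝ ∞ q) : Continuous (gradient q) :=
  (InnerProductSpace.toDual ℝ (Pt d)).symm.continuous.comp (hq.continuous_fderiv (by simp))

theorem hasCompactSupport_gradient {q : Pt d → ℝ} (hq : HasCompactSupport q) :
    HasCompactSupport (gradient q) :=
  (hq.fderiv (𝕜 := ℝ)).comp_left (g := (InnerProductSpace.toDual ℝ (Pt d)).symm) (map_zero _)

theorem integrableOn_inner_gradient {K : Set (Pt d)} {u : Pt d → Pt d}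
    (hu : MemLp u 2 (volume.restrict K)) {q : Pt d → ℝ} (hq : ContDiff ℝ ∞ q)
    (hqc : HasCompactSupport q) : IntegrableOn (fun x => inner ℝ (u x) (gradient q x)) K :=
  have hg := ((continuous_gradient hq).memLp_of_hasCompactSupport (p := 2) (μ := volume)
    (hasCompactSupport_gradient hqc)).restrict K
  (hu.norm.integrable_mul hg.norm).mono' (hu.1.inner hg.1)
    (Filter.Eventually.of_forall fun _ => norm_inner_le_norm (𝕜 := ℝ) _ _)

theorem integrableOn_mul_test {K : Set (Pt d)} {f : Pt d → ℝ}
    (hf : MemLp f 2 (volume.restrict K)) {q : Pt d → ℝ} (hq : ContDiff ℝ ∞ q)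
    (hqc : HasCompactSupport q) : IntegrableOn (fun x => f x * q x) K :=
  hf.integrable_mul
    ((hq.continuous.memLp_of_hasCompactSupport (p := 2) (μ := volume) hqc).restrict K)

theorem HasDivAndTrace.add {K S : Set (Pt d)} {u u' : Pt d → Pt d} {f f' : Pt d → ℝ}
    (hu : MemLp u 2 (volume.restrict K)) (hu' : MemLp u' 2 (volume.restrict K))
    (hf : MemLp f 2 (volume.restrict K)) (hf' : MemLp f' 2 (volume.restrict K))
    (h : HasDivAndTrace K S u f 0) (h' : HasDivAndTrace K S u' f' 0) :
    HasDivAndTrace K S (u + u') (f + f') 0 := by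
  intro q hq hqc hqS
  have e := h q hq hqc hqS
  have e' := h' q hq hqc hqS
  simp only [Pi.zero_apply, zero_mul, integral_zero] at e e' ⊢
  simp only [Pi.add_apply, inner_add_left, add_mul]
  rw [integral_add (integrableOn_inner_gradient hu hq hqc)
    (integrableOn_inner_gradient hu' hq hqc), integral_add (integrableOn_mul_test hf hq hqc)
    (integrableOn_mul_test hf' hq hqc)]
  linear_combination e + e'

theorem HasDivAndTrace.const_smul {K S : Set (Pt d)} {u : Pt d → Pt d} {f : Pt d → ℝ} (c : ℝ)
    (h : HasDivAndTrace K S u f 0) : HasDivAndTrace K S (c • u) (c • f) 0 := by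
  intro q hq hqc hqS
  have e := h q hq hqc hqS
  simp only [Pi.zero_apply, zero_mul, integral_zero] at e ⊢
  simp only [Pi.smul_apply, real_inner_smul_left, smul_eq_mul, mul_assoc]
  rw [integral_const_mul, integral_const_mul]
  linear_combination c * e

theorem HasDivAndTrace.congr {K S : Set (Pt d)} {u u' : Pt d → Pt d} {f g : Pt d → ℝ}
    (h : HasDivAndTrace K S u f g) (huu' : u =ᵐ[volume.restrict K] u') :
    HasDivAndTrace K S u' f g := by
  intro q hq hqc hqS
  rw [← h q hq hqc hqS]
  congr 1
  refine integral_congr_ae ?_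
  filter_upwards [huu'] with x hx
  rw [hx]

theorem HasDivAndTrace.zero (K S : Set (Pt d)) : HasDivAndTrace K S 0 0 0 := by
  intro q _ _ _
  simp

namespace Grid

variable {G : Grid D}

theorem ae_restrict_cell (T : Mesh D) {K : Set (Pt d)} (hK : K ∈ T.cells) {p : Pt d → Prop}
    (h : ∀ᵐ x ∂(volume.restrict D), p x) : ∀ᵐ x ∂(volume.restrict K), p x :=
  ae_mono (T.restrict_le (Mesh.subset_closure_of_mem hK)) h

theorem memLp_cell (T : Mesh D) {K : Set (Pt d)} (hK : K ∈ T.cells) (u : VecL2 D) :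
    MemLp u 2 (volume.restrict K) :=
  (Lp.memLp u).mono_measure (T.restrict_le (Mesh.subset_closure_of_mem hK))

/-- For zero flux the orientation sign drops out and integrability is automatic. What remains is
linear in the pair of field and divergence, so `zeroTrace` is a subspace. -/
theorem hasNormalTrace_zero_iff {E : G.Face} {u : Pt d → Pt d} :
    G.HasNormalTrace E u 0 ↔ ∀ K ∈ G.coarse.cells, E.1 ⊆ K → ∃ f : Pt d → ℝ,
      MemLp f 2 (volume.restrict K) ∧ HasDivAndTrace K E.1 u f 0 := by
  have h0 : ∀ s : ℝ, (fun x : Pt d => s * (0 : Pt d → ℝ) x) = 0 := fun s => by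
    ext; simp
  simp only [HasNormalTrace, h0]
  exact and_iff_right (integrableOn_zero)

theorem HasNormalTrace.congr {E : G.Face} {u u' : Pt d → Pt d} {g : Pt d → ℝ}
    (h : G.HasNormalTrace E u g)
    (huu' : ∀ K ∈ G.coarse.cells, E.1 ⊆ K → u =ᵐ[volume.restrict K] u') :
    G.HasNormalTrace E u' g := by
  refine ⟨h.1, fun K hK hEK => ?_⟩
  obtain ⟨f, hf, hdiv⟩ := h.2 K hK hEK
  exact ⟨f, hf, hdiv.congr (huu' K hK hEK)⟩

/-- The fields with vanishing normal trace on `E`. -/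
def zeroTrace (E : G.Face) : Submodule ℝ (VecL2 D) where
  carrier := {u | G.HasNormalTrace E u 0}
  zero_mem' := by
    refine hasNormalTrace_zero_iff.2 fun K hK _ => ⟨0, MemLp.zero, ?_⟩
    exact (HasDivAndTrace.zero K E.1).congr
      (ae_restrict_cell G.coarse hK (Lp.coeFn_zero (Pt d) 2 (volume.restrict D)).symm)
  add_mem' := by
    intro u v hu hv
    refine hasNormalTrace_zero_iff.2 fun K hK hEK => ?_
    obtain ⟨f, hf, h⟩ := hasNormalTrace_zero_iff.1 hu K hK hEK
    obtain ⟨f', hf', h'⟩ := hasNormalTrace_zero_iff.1 hv K hK hEK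
    exact ⟨f + f', hf.add hf', (h.add (memLp_cell _ hK u) (memLp_cell _ hK v) hf hf' h').congr
      (ae_restrict_cell G.coarse hK (Lp.coeFn_add u v).symm)⟩
  smul_mem' := by
    intro c u hu
    refine hasNormalTrace_zero_iff.2 fun K hK hEK => ?_
    obtain ⟨f, hf, h⟩ := hasNormalTrace_zero_iff.1 hu K hK hEK
    exact ⟨c • f, hf.const_smul c, (h.const_smul c).congr
      (ae_restrict_cell G.coarse hK (Lp.coeFn_smul c u).symm)⟩

theorem mem_zeroTrace {E : G.Face} {u : VecL2 D} :
    u ∈ zeroTrace E ↔ G.HasNormalTrace E u 0 := Iff.rfl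

/-- Almost every point of `K` lies in no other element, so it can belong to `ω_F` only through `K`
itself. -/
theorem ae_mem_omega {F : G.Face} {K : Set (Pt d)} (hK : K ∈ G.coarse.cells) :
    ∀ᵐ x ∂(volume.restrict K), x ∈ G.omega F → F.1 ⊆ K := by
  rw [ae_restrict_iff' (Mesh.measurableSet_of_mem hK)]
  filter_upwards [G.coarse.ae_unique_cell] with x hx hxK hxω
  obtain ⟨K', hK', hxK'⟩ := Set.mem_iUnion₂.1 hxω
  rw [Finset.mem_filter] at hK'
  exact hx K hK K' hK'.1 hxK hxK' ▸ hK'.2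

/-- A snapshot has no flux through the other coarse faces. -/
theorem IsSnapshot.mem_zeroTrace {κ : Pt d → ℝ} {E F : G.Face} (hEF : E ≠ F)
    {e : G.FineFace F} {ψ : VecL2 D} (h : G.IsSnapshot κ F e ψ) : ψ ∈ zeroTrace E := by
  refine Grid.mem_zeroTrace.2 (hasNormalTrace_zero_iff.2 fun K hK hEK => ?_)
  by_cases hFK : F.1 ⊆ K
  · obtain ⟨-, p, -, hp⟩ := h
    obtain ⟨-, -, hdiv⟩ := hp K hK hFK
    have : IsFiniteMeasure ((volume : Measure (Pt d)).restrict K) :=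
      ⟨by simpa using (Mesh.isCompact_of_mem hK).measure_lt_top⟩
    refine ⟨fun _ => G.divConst F e K, memLp_const _, fun q hq hqc hqE => ?_⟩
    rw [hdiv q hq hqc Set.inter_subset_right]
    simp only [Pi.zero_apply, zero_mul, integral_zero]
    refine integral_eq_zero_of_ae ?_
    -- On `∂K` the test function lives on `E` and the prescribed flux on `e ⊆ F`, so the boundary
    -- integrand vanishes off the null set `E ∩ F`.
    have hnull := Mesh.surf_inter_eq_zero E.2 F.2 (fun h => hEF (Subtype.ext h))
    filter_upwards [ae_restrict_of_ae (measure_eq_zero_iff_ae_notMem.1 hnull),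
      ae_restrict_mem isClosed_frontier.measurableSet] with x hx hxK
    by_cases hq0 : q x = 0
    · simp [hq0]
    · have hxE : x ∈ E.1 := hqE ⟨subset_tsupport q hq0, hxK⟩
      have hxe : x ∉ e.1 := fun hxe => hx ⟨hxE, (Finset.mem_filter.1 e.2).2 hxe⟩
      simp [flux, hxe]
  -- Here `K` is not one of the elements forming `ω_F`, so the snapshot vanishes almost everywhere
  -- on `K`.
  · refine ⟨0, MemLp.zero, (HasDivAndTrace.zero K E.1).congr ?_⟩
    filter_upwards [ae_mem_omega (F := F) hK, ae_restrict_cell G.coarse hK h.1] with x h1 h2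
    exact (h2 fun hx => hFK (h1 hx)).symm

end Grid

/-! ### Coarse neighborhoods and their finite overlap -/

namespace Grid

variable {d : ℕ} {D : Set (Pt d)} {G : Grid D}

theorem omega_subset_closure (E : G.Face) : G.omega E ⊆ closure D :=
  Set.iUnion₂_subset fun _ hK => Mesh.subset_closure_of_mem (Finset.mem_filter.1 hK).1

theorem measurableSet_omega (E : G.Face) : MeasurableSet (G.omega E) :=
  Finset.measurableSet_biUnion _ fun _ hK => Mesh.measurableSet_of_mem (Finset.mem_filter.1 hK).1

theorem exists_cell_of_face (E : G.Face) : ∃ K ∈ G.coarse.cells, E.1 ⊆ K := by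
  obtain ⟨K, hK, K', -, -, h⟩ := Mesh.exists_of_mem_faces E.2
  exact ⟨K, hK, h ▸ Set.inter_subset_left⟩

theorem subset_omega {E : G.Face} {K : Set (Pt d)} (hK : K ∈ G.coarse.cells) (hEK : E.1 ⊆ K) :
    K ⊆ G.omega E :=
  Set.subset_biUnion_of_mem (u := fun K : Set (Pt d) => K)
    (Finset.mem_coe.2 (Finset.mem_filter.2 ⟨hK, hEK⟩))

theorem card_le_M₁ {K : Set (Pt d)} (hK : K ∈ G.coarse.cells) :
    (Finset.univ.filter fun E : G.Face => K ⊆ G.omega E).card ≤ M₁ G :=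
  Finset.le_sup (f := fun K : Set (Pt d) =>
    (Finset.univ.filter fun E : G.Face => K ⊆ G.omega E).card) hK

theorem M₁_pos (hG : Nonempty G.Face) : 0 < M₁ G := by
  obtain ⟨E⟩ := hG
  obtain ⟨K, hK, hEK⟩ := exists_cell_of_face E
  exact (Finset.card_pos.2 ⟨E, by simpa using subset_omega hK hEK⟩).trans_le (card_le_M₁ hK)

/-- Every point of the domain lies in at most `M₁` of the coarse neighborhoods, up to a null
set. -/
theorem ae_card_omega_le (G : Grid D) :
    ∀ᵐ x ∂(volume.restrict D),
      (Finset.univ.filter fun E : G.Face => x ∈ G.omega E).card ≤ M₁ G := by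
  rw [ae_restrict_iff' G.coarse.isOpen_domain.measurableSet]
  filter_upwards [G.coarse.ae_unique_cell] with x hx hxD
  have hx' : x ∈ ⋃ K ∈ G.coarse.cells, K := by
    rw [G.coarse.union_eq]; exact subset_closure hxD
  obtain ⟨K, hK, hxK⟩ := Set.mem_iUnion₂.1 hx'
  refine (Finset.card_le_card ?_).trans (card_le_M₁ hK)
  refine Finset.monotone_filter_right _ fun E _ hxE => ?_
  obtain ⟨K', hK', hxK'⟩ := Set.mem_iUnion₂.1 hxE
  rw [Finset.mem_filter] at hK'
  obtain rfl := hx K hK K' hK'.1 hxK hxK'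
  exact subset_omega hK hK'.2

/-- Finite overlap of the coarse neighborhoods. -/
theorem sum_energy_omega_le {κ : Pt d → ℝ} {κmin κmax : ℝ} (hκ : BoundedCoeff D κ κmin κmax)
    (v : VecL2 D) : ∑ E : G.Face, energy κ (G.omega E) v v ≤ M₁ G * form κ v v := by
  let g : Pt d → ℝ := fun x => (κ x)⁻¹ * inner ℝ (v x) (v x)
  have hg : IntegrableOn g D := hκ.integrableOn_energy G.coarse subset_closure v v
  have hgc : IntegrableOn g (closure D) := hκ.integrableOn_energy G.coarse subset_rfl v v
  have hE : ∀ E : G.Face, energy κ (G.omega E) v v = ∫ x in D, (G.omega E).indicator g x := by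
    intro E
    rw [setIntegral_congr_set G.coarse.ae_domain_eq_closure,
      setIntegral_indicator (measurableSet_omega E),
      Set.inter_eq_right.2 (omega_subset_closure E)]
    rfl
  rw [Finset.sum_congr rfl fun E _ => hE E,
    ← integral_finsetSum _ fun E _ => hg.indicator (measurableSet_omega E), form, energy,
    ← integral_const_mul]
  refine integral_mono_ae (integrable_finsetSum _ fun E _ => hg.indicator (measurableSet_omega E))
    (hg.const_mul _) ?_
  filter_upwards [G.ae_card_omega_le, hκ.energy_integrand_nonneg v] with x hx h0
  have : ∑ E : G.Face, (G.omega E).indicator g x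
      = (Finset.univ.filter fun E : G.Face => x ∈ G.omega E).card * g x := by
    simp only [Set.indicator_apply]
    rw [← Finset.sum_filter, Finset.sum_const, nsmul_eq_mul]
  rw [this]
  exact mul_le_mul_of_nonneg_right (by exact_mod_cast hx) h0

/-! ### Snapshot spaces -/

variable {κ : Pt d → ℝ} {ψ : G.SnapFamily}

theorem snapLocal_le_zeroTrace (hψ : ∀ E e, G.IsSnapshot κ E e (ψ E e)) {E F : G.Face}
    (hEF : E ≠ F) : snapLocal ψ F ≤ zeroTrace E := by
  rw [snapLocal, Submodule.span_le]
  rintro _ ⟨e, rfl⟩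
  exact (hψ F e).mem_zeroTrace hEF

theorem snapLocal_le_supported (hψ : ∀ E e, G.IsSnapshot κ E e (ψ E e)) (E : G.Face) :
    snapLocal ψ E ≤ supported D (G.omega E) := by
  rw [snapLocal, Submodule.span_le]
  rintro _ ⟨e, rfl⟩
  exact (hψ E e).1

theorem snapLocal_le_snap (ψ : G.SnapFamily) (E : G.Face) : snapLocal ψ E ≤ snap ψ :=
  le_iSup (fun E => snapLocal ψ E) E

theorem snap2_le_snapLocal (ψ : G.SnapFamily) (E : G.Face) : snap2 ψ E ≤ snapLocal ψ E :=
  Submodule.span_le.2 fun _ h => h.1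

theorem snapLocal_le_snapRestr (hψ : ∀ E e, G.IsSnapshot κ E e (ψ E e)) (E : G.Face) :
    snapLocal ψ E ≤ snapRestr ψ E := by
  intro v hv
  refine Submodule.subset_span ⟨v, snapLocal_le_snap ψ E hv, ?_⟩
  filter_upwards [mem_supported.1 (snapLocal_le_supported hψ E hv)] with x hx
  by_cases h : x ∈ G.omega E
  · rw [Set.indicator_of_mem h]
  · rw [Set.indicator_of_notMem h, hx h]

theorem snapRestr_le_supported (ψ : G.SnapFamily) (E : G.Face) :
    snapRestr ψ E ≤ supported D (G.omega E) := by
  rw [snapRestr, Submodule.span_le]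
  rintro v ⟨w, -, hw⟩
  refine mem_supported.2 ?_
  filter_upwards [hw] with x hx h
  rw [hx, Set.indicator_of_notMem h]

theorem cutoff_mem_snapRestr (E : G.Face) {w : VecL2 D} (hw : w ∈ snap ψ) :
    cutoff D (measurableSet_omega E) w ∈ snapRestr ψ E :=
  Submodule.subset_span ⟨w, hw, coeFn_cutoff _ w⟩

instance finiteDimensional_snapLocal (ψ : G.SnapFamily) (E : G.Face) :
    FiniteDimensional ℝ (snapLocal ψ E) :=
  FiniteDimensional.span_of_finite ℝ (Set.finite_range _)

instance finiteDimensional_snap (ψ : G.SnapFamily) : FiniteDimensional ℝ (snap ψ) :=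
  Submodule.finiteDimensional_iSup _

instance finiteDimensional_snapRestr (ψ : G.SnapFamily) (E : G.Face) :
    FiniteDimensional ℝ (snapRestr ψ E) := by
  have hle : snapRestr ψ E ≤ (snap ψ).map (cutoff D (measurableSet_omega E)) := by
    rw [snapRestr, Submodule.span_le]
    rintro v ⟨w, hw, hvw⟩
    exact ⟨w, hw, Lp.ext ((coeFn_cutoff _ w).trans hvw.symm)⟩
  exact Submodule.finiteDimensional_of_le hle

/-- The restrictions to `ω_E` of snapshots that have no flux through `E`. -/
def corrections (ψ : G.SnapFamily) (E : G.Face) : Submodule ℝ (VecL2 D) :=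
  snapRestr ψ E ⊓ zeroTrace E

instance finiteDimensional_corrections (ψ : G.SnapFamily) (E : G.Face) :
    FiniteDimensional ℝ (corrections ψ E) :=
  Submodule.finiteDimensional_of_le inf_le_left

/-- Since `v` is itself admissible, the admissible fields form the coset `v + corrections ψ E`, and
the minimization becomes an orthogonal projection. -/
theorem admissible_iff (hψ : ∀ E e, G.IsSnapshot κ E e (ψ E e)) {E : G.Face} {v w : VecL2 D}
    (hv : v ∈ snapLocal ψ E) : Admissible ψ E v w ↔ w - v ∈ corrections ψ E := by
  have hv' := snapLocal_le_snapRestr hψ E hv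
  refine ⟨fun h => ⟨sub_mem h.1 hv', h.2⟩, fun h => ⟨?_, h.2⟩⟩
  simpa using add_mem h.1 hv'

/-- The restriction to `ω_E` of a sum of local snapshots is admissible for its `E` part. -/
theorem cutoff_sum_sub_mem_corrections (hψ : ∀ E e, G.IsSnapshot κ E e (ψ E e)) (E : G.Face)
    {v : G.Face → VecL2 D} (hv : ∀ F, v F ∈ snapLocal ψ F) :
    cutoff D (measurableSet_omega E) (∑ F, v F) - v E ∈ corrections ψ E := by
  refine ⟨sub_mem (cutoff_mem_snapRestr E (sum_mem fun F _ => snapLocal_le_snap ψ F (hv F)))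
    (snapLocal_le_snapRestr hψ E (hv E)), mem_zeroTrace.2 ?_⟩
  -- On the elements adjacent to `E` the cutoff changes nothing, so the difference there is the sum
  -- of the components of the other faces, which have no flux through `E`.
  have hrest : ∑ F, v F - v E ∈ zeroTrace E := by
    rw [← Finset.add_sum_erase _ _ (Finset.mem_univ E), add_sub_cancel_left]
    exact sum_mem fun F hF => snapLocal_le_zeroTrace hψ (Finset.ne_of_mem_erase hF).symm (hv F)
  refine (mem_zeroTrace.1 hrest).congr fun K hK hEK => ?_
  have h1 := ae_restrict_cell G.coarse hK (Lp.coeFn_sub (∑ F, v F) (v E))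
  have h2 := ae_restrict_cell G.coarse hK
    (Lp.coeFn_sub (cutoff D (measurableSet_omega E) (∑ F, v F)) (v E))
  have h3 := ae_restrict_cell G.coarse hK (coeFn_cutoff (measurableSet_omega E) (∑ F, v F))
  filter_upwards [h1, h2, h3, ae_restrict_mem (Mesh.measurableSet_of_mem hK)] with x h1 h2 h3 hx
  rw [h1, h2, Pi.sub_apply, Pi.sub_apply, h3, Set.indicator_of_mem (subset_omega hK hEK hx)]

theorem energy_cutoff (E : G.Face) (κ : Pt d → ℝ) (v : VecL2 D) :
    energy κ (G.omega E) (cutoff D (measurableSet_omega E) v)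
      (cutoff D (measurableSet_omega E) v) = energy κ (G.omega E) v v := by
  refine integral_congr_ae ?_
  filter_upwards [ae_mono (G.coarse.restrict_le (omega_subset_closure E))
    (coeFn_cutoff (measurableSet_omega E) v), ae_restrict_mem (measurableSet_omega E)] with x h hx
  rw [h, Set.indicator_of_mem hx]

/-! ### The local minimization and spectral problems -/

variable {κmin κmax : ℝ}

theorem energy_pos_of_mem_supported (hκ : BoundedCoeff D κ κmin κmax) {E : G.Face} {u : VecL2 D}
    (hu : u ∈ supported D (G.omega E)) (hu0 : u ≠ 0) : 0 < energy κ (G.omega E) u u := by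
  rw [energy_eq_form_of_mem_supported G.coarse κ (omega_subset_closure E) hu]
  exact hκ.form_pos G.coarse hu0

/-- The minimizer exists and is characterized by its Euler equation. -/
theorem minExt_spec (hκ : BoundedCoeff D κ κmin κmax) (hψ : ∀ E e, G.IsSnapshot κ E e (ψ E e))
    {E : G.Face} {v : VecL2 D} (hv : v ∈ snapLocal ψ E) :
    minExt κ ψ E v - v ∈ corrections ψ E ∧
      ∀ u ∈ corrections ψ E, energy κ (G.omega E) (minExt κ ψ E v) u = 0 := by
  let B := hκ.energyForm G.coarse (omega_subset_closure E)
  have hpos : ∀ u ∈ corrections ψ E, u ≠ 0 → 0 < B u u := fun u hu h0 =>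
    energy_pos_of_mem_supported hκ (snapRestr_le_supported ψ E hu.1) h0
  have hsymm : ∀ u w, B u w = B w u := energy_comm κ _
  obtain ⟨w₀, hw₀, horth⟩ := exists_orthogonal_representative B (corrections ψ E) hpos v
  -- Pythagoras makes `w₀` the unique minimizer, so the choice made by `Classical.epsilon` must be
  -- `w₀`.
  have hpyth : ∀ u ∈ corrections ψ E, B (w₀ + u) (w₀ + u) = B w₀ w₀ + B u u := by
    intro u hu
    simp only [map_add, LinearMap.add_apply, hsymm u w₀, horth u hu]
    ring
  have hex : ∃ w, Admissible ψ E v w ∧ ∀ w', Admissible ψ E v w' →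
      energy κ (G.omega E) w w ≤ energy κ (G.omega E) w' w' := by
    refine ⟨w₀, (admissible_iff hψ hv).2 hw₀, fun w' hw' => ?_⟩
    have hu : w' - w₀ ∈ corrections ψ E := by
      have := sub_mem ((admissible_iff hψ hv).1 hw') hw₀
      rwa [sub_sub_sub_cancel_right] at this
    have h1 := hpyth _ hu
    rw [add_sub_cancel] at h1
    have h2 : 0 ≤ B (w' - w₀) (w' - w₀) := hκ.energy_nonneg G.coarse (omega_subset_closure E) _
    change B w₀ w₀ ≤ B w' w'
    linarith
  obtain ⟨hadm, hmin⟩ := Classical.epsilon_spec hex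
  change Admissible ψ E v (minExt κ ψ E v) at hadm
  have hm : minExt κ ψ E v - v ∈ corrections ψ E := (admissible_iff hψ hv).1 hadm
  have hu : minExt κ ψ E v - w₀ ∈ corrections ψ E := by
    have := sub_mem hm hw₀
    rwa [sub_sub_sub_cancel_right] at this
  have heq : minExt κ ψ E v = w₀ := by
    by_contra hne
    have h1 := hpyth _ hu
    rw [add_sub_cancel] at h1
    have h2 : B (minExt κ ψ E v) (minExt κ ψ E v) ≤ B w₀ w₀ :=
      hmin w₀ ((admissible_iff hψ hv).2 hw₀)
    have h3 := hpos _ hu (sub_ne_zero.2 hne)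
    linarith
  exact ⟨hm, fun u hu => by rw [heq]; exact horth u hu⟩

theorem energy_minExt_le (hκ : BoundedCoeff D κ κmin κmax)
    (hψ : ∀ E e, G.IsSnapshot κ E e (ψ E e)) {E : G.Face} {v w : VecL2 D}
    (hv : v ∈ snapLocal ψ E) (hw : w - v ∈ corrections ψ E) :
    energy κ (G.omega E) (minExt κ ψ E v) (minExt κ ψ E v) ≤ energy κ (G.omega E) w w := by
  let B := hκ.energyForm G.coarse (omega_subset_closure E)
  obtain ⟨hm, horth⟩ := minExt_spec hκ hψ hv
  have hu : w - minExt κ ψ E v ∈ corrections ψ E := by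
    have := sub_mem hw hm
    rwa [sub_sub_sub_cancel_right] at this
  set m := minExt κ ψ E v
  have h1 : B m (w - m) = 0 := horth _ hu
  have h2 : 0 ≤ B (w - m) (w - m) := hκ.energy_nonneg G.coarse (omega_subset_closure E) _
  have h3 : B w m = B m w := energy_comm κ _ _ _
  simp only [map_sub, LinearMap.sub_apply] at h1 h2
  change B m m ≤ B w w
  linarith

theorem mem_smsCompl_iff (hκ : BoundedCoeff D κ κmin κmax) {E : G.Face} {n : ℕ}
    {φ : Basis (Fin n) ℝ (snap2 ψ E)} {J : Fin n} {v : VecL2 D} :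
    v ∈ smsCompl κ φ J ↔ v ∈ snap2 ψ E ∧ ∀ w ∈ sms φ J, form κ w v = 0 := by
  let B := hκ.energyForm G.coarse (subset_closure (s := D))
  refine ⟨fun hv => ?_, fun hv => Submodule.subset_span hv⟩
  induction hv using Submodule.span_induction with
  | mem x hx => exact hx
  | zero => exact ⟨zero_mem _, fun w _ => map_zero (B w)⟩
  | add x y _ _ hx hy =>
    refine ⟨add_mem hx.1 hy.1, fun w hw => ?_⟩
    change B w (x + y) = 0
    rw [map_add, show B w x = 0 from hx.2 w hw, show B w y = 0 from hy.2 w hw, add_zero]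
  | smul c x _ hx =>
    refine ⟨Submodule.smul_mem _ c hx.1, fun w hw => ?_⟩
    change B w (c • x) = 0
    rw [map_smul, show B w x = 0 from hx.2 w hw, smul_zero]

/-- The spectral gap estimate on the complement of the offline space. -/
theorem eigenvalue_mul_form_le (hκ : BoundedCoeff D κ κmin κmax)
    (hψ : ∀ E e, G.IsSnapshot κ E e (ψ E e)) {E : G.Face} {n : ℕ}
    {φ : Basis (Fin n) ℝ (snap2 ψ E)} {ev : Fin n → ℝ} (hφ : IsSpectralBasis κ ψ E φ ev)
    {J : Fin n} {v : VecL2 D} (hv : v ∈ smsCompl κ φ J) :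
    ev J * form κ v v ≤ energy κ (G.omega E) (minExt κ ψ E v) (minExt κ ψ E v) := by
  let B := hκ.energyForm G.coarse (omega_subset_closure E)
  let H : VecL2 D → VecL2 D := minExt κ ψ E
  obtain ⟨hv2, horth⟩ := (mem_smsCompl_iff hκ).1 hv
  have hloc : ∀ {u}, u ∈ snap2 ψ E → u ∈ snapLocal ψ E := fun h => snap2_le_snapLocal ψ E h
  have hform : ∀ {u : VecL2 D} (w : VecL2 D), u ∈ snap2 ψ E → B u w = form κ u w := fun w hu =>
    energy_eq_form_of_mem_supported G.coarse κ (omega_subset_closure E)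
      (snapLocal_le_supported hψ E (hloc hu)) w
  let f : Fin n → VecL2 D := fun i => (φ i : VecL2 D)
  have hf : ∀ i, f i ∈ snap2 ψ E := fun i => (φ i).2
  let c : Fin n → ℝ := fun i => φ.repr ⟨v, hv2⟩ i
  have hsum : ∑ i, c i • f i = v := by
    have h := congrArg (snap2 ψ E).subtype (φ.sum_repr ⟨v, hv2⟩)
    rw [map_sum] at h
    exact h
  have hev : ∀ i u, u ∈ snap2 ψ E → B (H (f i)) (H u) = ev i * B (f i) u := fun i u hu =>
    hφ.2 i u hu
  have hsymm : ∀ u w, B u w = B w u := energy_comm κ _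
  -- The energy of the extensions is symmetric, so testing the two eigenvalue equations against each
  -- other gives the commutation.
  have hcomm : ∀ i j, ev i * B (f i) (f j) = ev j * B (f i) (f j) := by
    intro i j
    rw [← hev i _ (hf j), hsymm (f i), ← hev j _ (hf i), hsymm]
  have hray := rayleigh_lower B (hκ.energy_nonneg G.coarse (omega_subset_closure E)) f ev hφ.1
    hcomm J c (fun j hj => by
      rw [hsum, hform v (hf j)]
      exact horth _ (Submodule.subset_span ⟨j, hj, rfl⟩))
  rw [hsum, hform v hv2] at hray
  refine hray.trans_eq ?_
  obtain ⟨hm, hmo⟩ := minExt_spec hκ hψ (hloc hv2)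
  -- Linearity of the minimizer is needed only modulo corrections, to which `H v` is orthogonal.
  have hN : ∑ j, c j • H (f j) - H v ∈ corrections ψ E := by
    have h1 : ∑ j, c j • (H (f j) - f j) ∈ corrections ψ E :=
      sum_mem fun j _ => Submodule.smul_mem _ _ (minExt_spec hκ hψ (hloc (hf j))).1
    have h2 := sub_mem h1 hm
    simp only [smul_sub, Finset.sum_sub_distrib, hsum] at h2
    rwa [sub_sub_sub_cancel_right] at h2
  have h0 : B (H v) (∑ j, c j • H (f j) - H v) = 0 := hmo _ hN
  rw [map_sub, sub_eq_zero, map_sum] at h0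
  change _ = B (H v) (H v)
  rw [← h0]
  refine Finset.sum_congr rfl fun j _ => ?_
  rw [map_smul, smul_eq_mul, hsymm (H v), hev j v hv2]

/-! ### Quadratic forms of the stiffness matrices -/

section Matrices

open Matrix

variable {r : G.Face → ℕ}

theorem dotProduct_stiffness_mulVec (hκ : BoundedCoeff D κ κmin κmax)
    (θ : ∀ E : G.Face, Fin (r E) → VecL2 D) (x : (Σ E : G.Face, Fin (r E)) → ℝ) :
    x ⬝ᵥ stiffness κ θ *ᵥ x
      = form κ (∑ E, ∑ i, x ⟨E, i⟩ • θ E i) (∑ E, ∑ i, x ⟨E, i⟩ • θ E i) := by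
  let B := hκ.energyForm G.coarse (subset_closure (s := D))
  change _ = B _ _
  rw [← Fintype.sum_sigma' (fun E i => x ⟨E, i⟩ • θ E i), map_sum]
  simp only [dotProduct, mulVec, map_smul, smul_eq_mul]
  refine Finset.sum_congr rfl fun i _ => ?_
  rw [map_sum, LinearMap.sum_apply]
  congr 1
  refine Finset.sum_congr rfl fun j _ => ?_
  rw [map_smul, LinearMap.smul_apply, smul_eq_mul, mul_comm]
  rfl

theorem dotProduct_blockJacobi_mulVec (hκ : BoundedCoeff D κ κmin κmax)
    (θ : ∀ E : G.Face, Fin (r E) → VecL2 D) (x : (Σ E : G.Face, Fin (r E)) → ℝ) :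
    x ⬝ᵥ blockJacobi κ θ *ᵥ x
      = ∑ E, form κ (∑ i, x ⟨E, i⟩ • θ E i) (∑ i, x ⟨E, i⟩ • θ E i) := by
  let B := hκ.energyForm G.coarse (subset_closure (s := D))
  change _ = ∑ E, B _ _
  simp only [dotProduct, mulVec, Fintype.sum_sigma]
  refine Finset.sum_congr rfl fun E _ => ?_
  rw [map_sum]
  refine Finset.sum_congr rfl fun i _ => ?_
  rw [map_smul, smul_eq_mul, map_sum, LinearMap.sum_apply]
  congr 1
  rw [Finset.sum_eq_single E]
  · refine Finset.sum_congr rfl fun j _ => ?_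
    rw [map_smul, LinearMap.smul_apply, smul_eq_mul, mul_comm, blockJacobi,
      blockDiagonal'_apply_eq]
    rfl
  · intro F _ hF
    refine Finset.sum_eq_zero fun j _ => ?_
    rw [blockJacobi, blockDiagonal'_apply_ne _ _ _ hF.symm, zero_mul]
  · intro h
    exact absurd (Finset.mem_univ E) h

theorem stiffness_isSymm (κ : Pt d → ℝ) (θ : ∀ E : G.Face, Fin (r E) → VecL2 D) :
    (stiffness κ θ).IsSymm := by
  ext i j
  exact energy_comm κ D _ _

theorem blockJacobi_isSymm (κ : Pt d → ℝ) (θ : ∀ E : G.Face, Fin (r E) → VecL2 D) :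
    (blockJacobi κ θ).IsSymm := by
  rw [Matrix.IsSymm, blockJacobi, blockDiagonal'_transpose]
  congr 1
  ext E i j
  exact energy_comm κ D _ _

end Matrices

/-! ### Two-sided bounds for the energy of a sum -/

/-- The form of a sum is bounded through the number of interactions between the summands. -/
theorem form_sum_le (hκ : BoundedCoeff D κ κmin κmax) (W : G.Face → Submodule ℝ (VecL2 D))
    {v : G.Face → VecL2 D} (hv : ∀ E, v E ∈ W E) :
    form κ (∑ E, v E) (∑ E, v E) ≤ M₂ κ W * ∑ E, form κ (v E) (v E) := by
  let B := hκ.energyForm G.coarse (subset_closure (s := D))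
  have hsymm : ∀ u w, B u w = B w u := energy_comm κ _
  have hnn : ∀ u, 0 ≤ B u u := hκ.energy_nonneg G.coarse subset_closure
  let R : G.Face → G.Face → Prop := fun E F => ¬ ∀ v ∈ W F, ∀ w ∈ W E, form κ v w = 0
  have hR : ∀ E F, R E F ↔ R F E := by
    intro E F
    refine not_congr ⟨fun h v hv w hw => ?_, fun h v hv w hw => ?_⟩
    · exact (hsymm v w).trans (h w hw v hv)
    · exact (hsymm v w).trans (h w hw v hv)
  -- Each interacting pair charges half an energy to either index. Interaction is symmetric, so both
  -- halves sum to the same total, with at most `M₂` charges per index.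
  have hterm : ∀ E F, B (v E) (v F)
      ≤ (if R E F then B (v E) (v E) / 2 else 0) + (if R F E then B (v F) (v F) / 2 else 0) := by
    intro E F
    by_cases h : R E F
    · rw [if_pos h, if_pos ((hR E F).1 h)]
      have := hnn (v E - v F)
      simp only [map_sub, LinearMap.sub_apply] at this
      linarith [hsymm (v E) (v F)]
    · rw [if_neg h, if_neg fun h' => h ((hR E F).2 h'), add_zero]
      exact ((hsymm _ _).trans (not_not.1 h _ (hv F) _ (hv E))).le
  have hcount : ∀ E, (∑ F, if R E F then B (v E) (v E) / 2 else 0)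
      ≤ M₂ κ W * (B (v E) (v E) / 2) := by
    intro E
    rw [← Finset.sum_filter, Finset.sum_const, nsmul_eq_mul]
    refine mul_le_mul_of_nonneg_right ?_ (by linarith [hnn (v E)])
    exact_mod_cast Finset.le_sup (f := fun E : G.Face => (Finset.univ.filter fun F : G.Face =>
      ¬ ∀ v ∈ W F, ∀ w ∈ W E, form κ v w = 0).card) (Finset.mem_univ E)
  change B _ _ ≤ _ * ∑ E, B (v E) (v E)
  calc B (∑ E, v E) (∑ E, v E) = ∑ E, ∑ F, B (v E) (v F) := by
        simp only [map_sum, LinearMap.sum_apply]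
        exact Finset.sum_comm
    _ ≤ ∑ E, ∑ F, ((if R E F then B (v E) (v E) / 2 else 0)
          + (if R F E then B (v F) (v F) / 2 else 0)) :=
        Finset.sum_le_sum fun E _ => Finset.sum_le_sum fun F _ => hterm E F
    _ = 2 * ∑ E, ∑ F, (if R E F then B (v E) (v E) / 2 else 0) := by
        simp only [Finset.sum_add_distrib]
        rw [Finset.sum_comm (f := fun E F => if R F E then B (v F) (v F) / 2 else 0)]
        ring
    _ ≤ 2 * ∑ E, M₂ κ W * (B (v E) (v E) / 2) := by
        gcongr with E _
        exact hcount E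
    _ = M₂ κ W * ∑ E, B (v E) (v E) := by
        rw [← Finset.mul_sum, ← Finset.sum_div]
        ring

/-- Stable decomposition: the sum of the energies of the components is controlled by the energy
of the sum. -/
theorem mul_sum_form_le (hκ : BoundedCoeff D κ κmin κmax)
    (hψ : ∀ E e, G.IsSnapshot κ E e (ψ E e)) {n : G.Face → ℕ}
    {φ : ∀ E, Basis (Fin (n E)) ℝ (snap2 ψ E)} {ev : ∀ E, Fin (n E) → ℝ}
    (hφ : ∀ E, IsSpectralBasis κ ψ E (φ E) (ev E)) {J : ∀ E, Fin (n E)}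
    {v : G.Face → VecL2 D} (hv : ∀ E, v E ∈ smsCompl κ (φ E) (J E)) :
    (⨅ E : G.Face, ev E (J E)) * ∑ E, form κ (v E) (v E)
      ≤ M₁ G * form κ (∑ E, v E) (∑ E, v E) := by
  have hloc : ∀ E, v E ∈ snapLocal ψ E := fun E =>
    snap2_le_snapLocal ψ E ((mem_smsCompl_iff hκ).1 (hv E)).1
  refine le_trans ?_ (sum_energy_omega_le hκ _)
  rw [Finset.mul_sum]
  refine Finset.sum_le_sum fun E _ => ?_
  have hΛ : (⨅ E : G.Face, ev E (J E)) ≤ ev E (J E) :=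
    ciInf_le (Set.finite_range fun E : G.Face => ev E (J E)).bddBelow E
  have h0 : 0 ≤ form κ (v E) (v E) := hκ.energy_nonneg G.coarse subset_closure (v E)
  have h1 := eigenvalue_mul_form_le hκ hψ (hφ E) (hv E)
  have h2 := energy_minExt_le hκ hψ (hloc E) (cutoff_sum_sub_mem_corrections hψ E hloc)
  rw [energy_cutoff] at h2
  exact ((mul_le_mul_of_nonneg_right hΛ h0).trans h1).trans h2

/-- The index `J : Fin n` starts at zero, so `φ J` is the first eigenfunction left out of `sms φ J`;
making it orthogonal to that space leaves a nonzero vector. This guarantees that the preconditioned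
matrix is not empty. -/
theorem smsCompl_ne_bot (hκ : BoundedCoeff D κ κmin κmax) {E : G.Face} {n : ℕ}
    (φ : Basis (Fin n) ℝ (snap2 ψ E)) (J : Fin n) : smsCompl κ φ J ≠ ⊥ := by
  let B := hκ.energyForm G.coarse (subset_closure (s := D))
  have hsub : sms φ J ≤ snap2 ψ E := by
    rw [sms, Submodule.span_le]
    rintro _ ⟨j, -, rfl⟩
    exact (φ j).2
  have : FiniteDimensional ℝ (snap2 ψ E) := φ.finiteDimensional_of_finite
  have : FiniteDimensional ℝ (sms φ J) := Submodule.finiteDimensional_of_le hsub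
  obtain ⟨w, hw, horth⟩ := exists_orthogonal_representative B (sms φ J)
    (fun u _ hu => hκ.form_pos G.coarse hu) (φ J : VecL2 D)
  have hw2 : w ∈ snap2 ψ E := by
    simpa using add_mem (hsub hw) (φ J).2
  have hmem : w ∈ smsCompl κ φ J := (mem_smsCompl_iff hκ).2
    ⟨hw2, fun u hu => (energy_comm κ D u w).trans (horth u hu)⟩
  intro hbot
  rw [hbot, Submodule.mem_bot] at hmem
  rw [hmem, zero_sub, neg_mem_iff] at hw
  have hli : LinearIndependent ℝ fun j => (φ j : VecL2 D) :=
    φ.linearIndependent.map' (snap2 ψ E).subtype (Submodule.ker_subtype _)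
  refine hli.notMem_span_image (s := {j | j < J}) (x := J) (lt_irrefl J) ?_
  have himage : (fun j => (φ j : VecL2 D)) '' {j | j < J} =
      {v : VecL2 D | ∃ j, j < J ∧ v = φ j} := by
    ext u
    exact exists_congr fun j => and_congr_right fun _ => eq_comm
  rw [himage]
  exact hw

end Grid

end CEMGMsFEM

end

/-! ### Condition number bound -/

theorem mainTheorem2 {d : ℕ} (hd : d = 2 ∨ d = 3) (D : Set (CEMGMsFEM.Pt d))
    (G : CEMGMsFEM.Grid D) (hG : Nonempty G.Face)
    (κ : CEMGMsFEM.Pt d → ℝ) (hκ : AEMeasurable κ (volume.restrict D))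
    (κmin κmax : ℝ) (hκmin : 0 < κmin)
    (hκbd : ∀ᵐ x ∂(volume.restrict D), κmin ≤ κ x ∧ κ x ≤ κmax)
    (ψ : G.SnapFamily) (hψ : ∀ E e, G.IsSnapshot κ E e (ψ E e))
    (n : G.Face → ℕ)
    (φ : ∀ E, Basis (Fin (n E)) ℝ (CEMGMsFEM.Grid.snap2 ψ E))
    (ev : ∀ E, Fin (n E) → ℝ)
    (hφ : ∀ E, CEMGMsFEM.Grid.IsSpectralBasis κ ψ E (φ E) (ev E))
    (J : ∀ E, Fin (n E))
    (r : G.Face → ℕ)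
    (θ : ∀ E, Basis (Fin (r E)) ℝ (CEMGMsFEM.Grid.smsCompl κ (φ E) (J E))) :
    let W : G.Face → Submodule ℝ (CEMGMsFEM.VecL2 D) :=
      fun E => CEMGMsFEM.Grid.smsCompl κ (φ E) (J E)
    let Θ : ∀ E : G.Face, Fin (r E) → CEMGMsFEM.VecL2 D := fun E i => (θ E i : CEMGMsFEM.VecL2 D)
    let Λ : ℝ := ⨅ E : G.Face, ev E (J E)
    IsUnit (CEMGMsFEM.Grid.blockJacobi κ Θ) ∧
    (∀ z : ℂ, Module.End.HasEigenvalue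
      ((CEMGMsFEM.Grid.precond κ Θ).map (fun x : ℝ => (x : ℂ))).mulVecLin z → z.im = 0) ∧
    ∃ μmin μmax : ℝ,
      IsLeast {μ : ℝ | Module.End.HasEigenvalue (CEMGMsFEM.Grid.precond κ Θ).mulVecLin μ} μmin ∧
      IsGreatest {μ : ℝ | Module.End.HasEigenvalue (CEMGMsFEM.Grid.precond κ Θ).mulVecLin μ}
        μmax ∧
      Λ * (CEMGMsFEM.Grid.M₁ G : ℝ)⁻¹ ≤ μmin ∧ μmin ≤ μmax ∧
      μmax ≤ (CEMGMsFEM.Grid.M₂ κ W : ℝ) := by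
  have hc : CEMGMsFEM.BoundedCoeff D κ κmin κmax := ⟨hκ, hκmin, hκbd⟩
  intro W Θ Λ
  have hmem : ∀ (x : (Σ E : G.Face, Fin (r E)) → ℝ) (E : G.Face),
      ∑ i, x ⟨E, i⟩ • Θ E i ∈ W E := fun x E =>
    sum_mem fun i _ => Submodule.smul_mem _ _ (θ E i).2
  have hne : Nonempty (Σ E : G.Face, Fin (r E)) := by
    obtain ⟨E⟩ := hG
    have : Nontrivial (W E) :=
      Submodule.nontrivial_iff_ne_bot.2 (CEMGMsFEM.Grid.smsCompl_ne_bot hc (φ E) (J E))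
    exact ⟨⟨E, (θ E).index_nonempty.some⟩⟩
  have hM₁ : (0 : ℝ) < CEMGMsFEM.Grid.M₁ G := by
    exact_mod_cast CEMGMsFEM.Grid.M₁_pos hG
  refine CEMGMsFEM.eigenvalues_of_rayleigh_bounds (CEMGMsFEM.Grid.stiffness_isSymm κ Θ)
    (CEMGMsFEM.Grid.blockJacobi_isSymm κ Θ) (fun x hx => ?_) (fun x => ?_) (fun x => ?_)
  · rw [CEMGMsFEM.Grid.dotProduct_blockJacobi_mulVec hc]
    -- One block with a nonzero coefficient is enough: its basis is independent, so its component
    -- has positive energy, and the other blocks contribute nonnegative terms.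
    obtain ⟨⟨E, i⟩, hi⟩ := Function.ne_iff.1 hx
    refine Finset.sum_pos' (fun F _ => hc.energy_nonneg G.coarse subset_closure _)
      ⟨E, Finset.mem_univ E, hc.form_pos G.coarse fun h0 => hi ?_⟩
    have hli : LinearIndependent ℝ (Θ E) :=
      (θ E).linearIndependent.map' (W E).subtype (Submodule.ker_subtype _)
    exact Fintype.linearIndependent_iff.1 hli (fun i => x ⟨E, i⟩) h0 i
  · rw [CEMGMsFEM.Grid.dotProduct_blockJacobi_mulVec hc,
      CEMGMsFEM.Grid.dotProduct_stiffness_mulVec hc, mul_right_comm, ← div_eq_mul_inv,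
      div_le_iff₀ hM₁, mul_comm _ (CEMGMsFEM.Grid.M₁ G : ℝ)]
    exact CEMGMsFEM.Grid.mul_sum_form_le hc hψ hφ (hmem x)
  · rw [CEMGMsFEM.Grid.dotProduct_blockJacobi_mulVec hc,
      CEMGMsFEM.Grid.dotProduct_stiffness_mulVec hc]
    exact CEMGMsFEM.Grid.form_sum_le hc W (hmem x)
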